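/- **Setting.** Let $d=1+s$, write $p\cdot x=p_0x_0-\mathbf p\cdot\mathbf x$ for the Minkowski product on $\mathbb R^{d}=\mathbb R^{1+s}$, and let $V_+=\{p: p_0\ge|\mathbf p|\}$. Consider a Haag--Kastler quantum field theory in its vacuum representation: a net $O\mapsto\mathcal A(O)$ of unital $C^*$-algebras with common unit, indexed by the bounded open sets $O\subset\mathbb R^d$, which satisfies isotony and microcausality and has inductive limit $\mathcal A$; translation automorphisms $\alpha_x$ of $\mathcal A$ with $\alpha_x\mathcal A(O)=\mathcal A(O+x)$; a translation-invariant vacuum state with GNS triple $(\pi_0,\mathcal H,\Omega)$; and a strongly continuous unitary representation $U$ of $\mathbb R^d$ on $\mathcal H$ that implements $\alpha$ and whose invariant vectors are exactly the multiples of $\Omega$. Write $U(x)=e^{iP\cdot x}$ with energy-momentum operator $P=(H,\mathbf P)$, and let $E$ be the joint spectral measure and $\sigma(P)$ the joint spectrum of $P$. Assume that, for some $m>0$, $$\{0\}\cup H_m\subset\sigma(P)\subset\{0\}\cup H_m\cup G_{2m},$$ where $H_m=\{p: p_0=\sqrt{m^2+|\mathbf p|^2}\}$ and $G_{2m}=\{p: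 p_0\ge\sqrt{4m^2+|\mathbf p|^2}\}$. Let $\mathcal R(O)=\pi_0(\mathcal A(O))''$ and $\mathcal R=\pi_0(\mathcal A)''$. For $A\in\mathcal R$ put $A(x)=U(x)AU(x)^*$ and $A(\mathbf x)=A(0,\mathbf x)$. The operator $A$ is *almost local* if there are $A_r\in\mathcal R(K_r)$, $r>0$, where $K_r$ is the double cone of radius $r$ centred at the origin, such that for every $N\in\mathbb N$ there is $C_N$ with $\|A-A_r\|\le C_Nr^{-N}$ for all $r>0$. The *Arveson spectrum* $\sigma_\alpha(A)$ is the support of the operator-valued distribution $p\mapsto(2\pi)^{-d}\int_{\mathbb R^d}e^{-ip\cdot x}A(x)\,dx$. A *creation operator* is an almost local $B^*\in\mathcal R$ such that $\sigma_\alpha(B^*)$ is a compact subset of $V_+$ and $\emptyset\ne\sigma_\alpha(B^*)\cap\sigma(P)\subset H_m$. **Proposition.** Let $B^*$ be a creation operator and $\Delta\subset\mathbb R^d$ compact. If $\psi\in E(\Delta)\mathcal H$ is an eigenvector of the mass operator $M=\sqrt{H^2-|\mathbf P|^2}$, then for every $t\in\mathbb R$ the function $\mathbf x\mapsto\langle e^{-itH}\psi,(B^*B)(\mathbf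 x)\,e^{-itH}\psi\rangle$ is integrable on $\mathbb R^s$, and $$\int_{\mathbb R^s}\langle e^{-itH}\psi,(B^*B)(\mathbf x)\,e^{-itH}\psi\rangle\,d\mathbf x=\int_{\mathbb R^s}\langle\psi,(B^*B)(\mathbf x)\,\psi\rangle\,d\mathbf x .$$ -/

import Mathlib

open MeasureTheory
open scoped ContDiff InnerProductSpace

namespace HaagKastler

noncomputable section

/-! ### Minkowski space -/

/-- Minkowski space `ℝ^d = ℝ^{1+s}`: pairs of a time (energy) and a space (momentum) component. -/
abbrev Spacetime (s : ℕ) : Type := ℝ × EuclideanSpace ℝ (Fin s)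

/-- The Minkowski product `p · x = p₀ x₀ - 𝐩 · 𝐱`. -/
def minkowski {s : ℕ} (p x : Spacetime s) : ℝ := p.1 * x.1 - ⟪p.2, x.2⟫_ℝ

/-- The plane wave `e^{i p · x}`. -/
def planeWave {s : ℕ} (p x : Spacetime s) : ℂ :=
  Complex.exp (Complex.I * (minkowski p x : ℂ))

/-- The index set of the net: bounded open subsets of Minkowski space. -/
def IsRegion {s : ℕ} (O : Set (Spacetime s)) : Prop := IsOpen O ∧ Bornology.IsBounded O

/-- The causal complement of `O`: the points that are spacelike to every point of `O`. -/
def causalComplement {s : ℕ} (O : Set (Spacetime s)) : Set (Spacetime s) :=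
  {y | ∀ x ∈ O, (y.1 - x.1) ^ 2 < ‖y.2 - x.2‖ ^ 2}

/-- The double cone `K_r` of radius `r` centred at the origin. -/
def doubleCone (s : ℕ) (r : ℝ) : Set (Spacetime s) := {x | |x.1| + ‖x.2‖ < r}

/-- The closed forward light cone `V₊`. -/
def forwardCone (s : ℕ) : Set (Spacetime s) := {p | ‖p.2‖ ≤ p.1}

/-- The mass hyperboloid `H_m`. -/
def massHyperboloid (s : ℕ) (m : ℝ) : Set (Spacetime s) :=
  {p | p.1 = Real.sqrt (m ^ 2 + ‖p.2‖ ^ 2)}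

/-- The set `{p | p₀ ≥ √(μ² + |𝐩|²)}`; for `μ = 2 m` this is the multi-particle region. -/
def aboveHyperboloid (s : ℕ) (μ : ℝ) : Set (Spacetime s) :=
  {p | Real.sqrt (μ ^ 2 + ‖p.2‖ ^ 2) ≤ p.1}

section HilbertSpace

variable {s : ℕ} {H : Type*} [NormedAddCommGroup H] [InnerProductSpace ℂ H]

/-! ### Fourier support of operator-valued functions -/

/-- The operator-valued distribution `F̌(p) = (2π)^{-d} ∫ e^{-i p · x} F(x) dx`, evaluated on the
test function `g` and the matrix element `⟪ψ, · φ⟫`. -/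
def fourierPairing (F : Spacetime s → H →L[ℂ] H) (g : Spacetime s → ℂ) (ψ φ : H) : ℂ :=
  ((2 * Real.pi : ℂ) ^ (1 + s))⁻¹ *
    ∫ x : Spacetime s, (∫ p : Spacetime s, g p * planeWave (-p) x) * ⟪ψ, F x φ⟫_ℂ

/-- The support of the operator-valued distribution `F̌`: the complement of the union of all open
sets on which it vanishes. -/
def fourierSupport (F : Spacetime s → H →L[ℂ] H) : Set (Spacetime s) :=
  {p | ∃ O : Set (Spacetime s), IsOpen O ∧ p ∈ O ∧
    ∀ g : Spacetime s → ℂ, ContDiff ℝ ∞ g → HasCompactSupport g → tsupport g ⊆ O →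
      ∀ ψ φ : H, fourierPairing F g ψ φ = 0}ᶜ

variable [CompleteSpace H]

/-- The translate `A(x) = U(x) A U(x)*`. -/
def translate (U : Spacetime s → unitary (H →L[ℂ] H)) (A : H →L[ℂ] H) (x : Spacetime s) :
    H →L[ℂ] H :=
  (U x : H →L[ℂ] H) * A * star (U x : H →L[ℂ] H)

/-- The energy-momentum transfer (Arveson spectrum) `σ_α(A)` of an operator `A`. -/
def arvesonSpectrum (U : Spacetime s → unitary (H →L[ℂ] H)) (A : H →L[ℂ] H) :
    Set (Spacetime s) :=
  fourierSupport (translate U A)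

/-! ### Joint spectral theory of the generators `P = (H, 𝐏)` of `U(x) = e^{i P · x}`

Throughout, `E` denotes the joint spectral measure of `P`, so that `U(x) = ∫ e^{i p · x} dE(p)`. -/

/-- `μ` is the spectral measure `⟪ψ, E(·) ψ⟫` of the vector `ψ`: the (unique) finite Borel measure
with `⟪ψ, U(x) ψ⟫ = ∫ e^{i p · x} dμ(p)` for all `x`. -/
structure IsSpectralMeasure (U : Spacetime s → unitary (H →L[ℂ] H)) (ψ : H)
    (μ : Measure (Spacetime s)) : Prop where
  finite : IsFiniteMeasure μ
  inner_eq : ∀ x, ⟪ψ, (U x : H →L[ℂ] H) ψ⟫_ℂ = ∫ p, planeWave p x ∂μ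

/-- The range `E(Δ)ℋ` of the spectral projection `E(Δ)`: the vectors `ψ` whose spectral measure
`⟪ψ, E(·) ψ⟫` vanishes outside `Δ`. -/
def spectralSubspace (U : Spacetime s → unitary (H →L[ℂ] H)) (Δ : Set (Spacetime s)) : Set H :=
  {ψ | ∃ μ : Measure (Spacetime s), IsSpectralMeasure U ψ μ ∧ μ Δᶜ = 0}

/-- The joint spectrum `σ(P)`. Since `E = (2π)^{-d} ∫ e^{-i p · x} U(x) dx` as an operator-valued
distribution, the support of `E` is the Fourier support of `U`. -/
def jointSpectrum (U : Spacetime s → unitary (H →L[ℂ] H)) : Set (Spacetime s) :=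
  fourierSupport (fun x => (U x : H →L[ℂ] H))

/-- The graph of the (possibly unbounded) operator `f(P) = ∫ f(p) dE(p)`. With
`μ = ⟪ψ, E(·) ψ⟫`, the vector `ψ` is in the domain iff `f ∈ L²(μ)`, and `φ = f(P) ψ` is the unique
vector with `⟪U(x) ψ, φ⟫ = ∫ e^{-i p · x} f(p) dμ(p)` for all `x` (this fixes the component of `φ`
in the cyclic subspace of `ψ`) and `‖φ‖² = ∫ |f|² dμ` (so there is no other component). -/
def functionalCalculusGraph (U : Spacetime s → unitary (H →L[ℂ] H)) (f : Spacetime s → ℂ) :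
    Set (H × H) :=
  {z | ∃ μ : Measure (Spacetime s), IsSpectralMeasure U z.1 μ ∧ MemLp f 2 μ ∧
    (∀ x, ⟪(U x : H →L[ℂ] H) z.1, z.2⟫_ℂ = ∫ p, planeWave (-p) x * f p ∂μ) ∧
    ‖z.2‖ ^ 2 = ∫ p, ‖f p‖ ^ 2 ∂μ}

/-- The graph of the mass operator `M = √(H² - |𝐏|²)`. -/
def massOperatorGraph (U : Spacetime s → unitary (H →L[ℂ] H)) : Set (H × H) :=
  functionalCalculusGraph U (fun p => (Real.sqrt (p.1 ^ 2 - ‖p.2‖ ^ 2) : ℂ))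

/-- `ψ` is an eigenvector of the mass operator: `ψ ≠ 0` and `M ψ = c ψ` for some scalar `c`. -/
def IsMassEigenvector (U : Spacetime s → unitary (H →L[ℂ] H)) (ψ : H) : Prop :=
  ψ ≠ 0 ∧ ∃ c : ℂ, (ψ, c • ψ) ∈ massOperatorGraph U

/-- The time evolution `e^{-i t H} = U(-t, 0)`. -/
def timeEvolution (U : Spacetime s → unitary (H →L[ℂ] H)) (t : ℝ) : H →L[ℂ] H :=
  (U (-t, 0) : H →L[ℂ] H)

/-- The von Neumann algebra generated by a set of operators (double commutant of `S ∪ S*`). -/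
def generatedVonNeumann (S : Set (H →L[ℂ] H)) : VonNeumannAlgebra H where
  toStarSubalgebra :=
    StarSubalgebra.centralizer ℂ (StarSubalgebra.centralizer ℂ S : Set (H →L[ℂ] H))
  centralizer_centralizer' := by simp

end HilbertSpace

/-! ### Haag-Kastler quantum field theories -/

/-- A Haag-Kastler quantum field theory on `ℝ^{1+s}` in its vacuum representation, with an
isolated mass shell of mass `m` (upper and lower mass gap). -/
structure QFT (s : ℕ) (m : ℝ) (𝔄 : Type*) [CStarAlgebra 𝔄]
    (H : Type*) [NormedAddCommGroup H] [InnerProductSpace ℂ H] [CompleteSpace H] where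
  mass_pos : 0 < m
  /-- The net `O ↦ 𝒜(O)`; only its values on bounded open sets matter. -/
  net : Set (Spacetime s) → StarSubalgebra ℂ 𝔄
  isClosed_net : ∀ O, IsRegion O → IsClosed (net O : Set 𝔄)
  isotony : ∀ O₁ O₂, IsRegion O₁ → IsRegion O₂ → O₁ ⊆ O₂ → net O₁ ≤ net O₂
  microcausality : ∀ O₁ O₂, IsRegion O₁ → IsRegion O₂ → O₁ ⊆ causalComplement O₂ →
    ∀ a ∈ net O₁, ∀ b ∈ net O₂, a * b = b * a
  /-- The global algebra is the inductive limit of the net. -/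
  dense_net : Dense (⋃ O ∈ {O : Set (Spacetime s) | IsRegion O}, (net O : Set 𝔄))
  /-- The translation automorphisms. -/
  α : Spacetime s → (𝔄 ≃⋆ₐ[ℂ] 𝔄)
  α_add : ∀ x y a, α (x + y) a = α x (α y a)
  α_net : ∀ O x, IsRegion O → α x '' (net O : Set 𝔄) = (net ((fun y => y + x) '' O) : Set 𝔄)
  /-- The vacuum state. -/
  ρ₀ : 𝔄 →ₗ[ℂ] ℂ
  ρ₀_nonneg : ∀ a, ∃ r : ℝ, 0 ≤ r ∧ ρ₀ (star a * a) = (r : ℂ)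
  ρ₀_one : ρ₀ 1 = 1
  ρ₀_α : ∀ x a, ρ₀ (α x a) = ρ₀ a
  /-- The representation and the cyclic vector of the GNS triple of the vacuum state. -/
  π₀ : 𝔄 →⋆ₐ[ℂ] (H →L[ℂ] H)
  Ω : H
  cyclic : Dense (Set.range fun a => π₀ a Ω)
  gns : ∀ a, ⟪Ω, π₀ a Ω⟫_ℂ = ρ₀ a
  /-- The strongly continuous unitary representation of the translations. -/
  U : Spacetime s → unitary (H →L[ℂ] H)
  U_add : ∀ x y, U (x + y) = U x * U y
  U_continuous : ∀ ψ : H, Continuous fun x => (U x : H →L[ℂ] H) ψ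
  covariance : ∀ x a, π₀ (α x a) = translate U (π₀ a) x
  vacuum_unique : ∀ ψ : H, (∀ x, (U x : H →L[ℂ] H) ψ = ψ) ↔ ∃ c : ℂ, ψ = c • Ω
  /-- The strong spectrum condition. -/
  spectrum_lower : {0} ∪ massHyperboloid s m ⊆ jointSpectrum U
  spectrum_upper : jointSpectrum U ⊆
    {0} ∪ massHyperboloid s m ∪ aboveHyperboloid s (2 * m)

namespace QFT

variable {s : ℕ} {m : ℝ} {𝔄 : Type*} [CStarAlgebra 𝔄]
  {H : Type*} [NormedAddCommGroup H] [InnerProductSpace ℂ H] [CompleteSpace H]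

/-- The local observable algebra `ℛ(O)`. -/
def localAlgebra (Q : QFT s m 𝔄 H) (O : Set (Spacetime s)) : VonNeumannAlgebra H :=
  generatedVonNeumann (Q.π₀ '' (Q.net O : Set 𝔄))

/-- The global observable algebra `ℛ`. -/
def globalAlgebra (Q : QFT s m 𝔄 H) : VonNeumannAlgebra H :=
  generatedVonNeumann (Set.range Q.π₀)

/-- `A` is almost local: there are `A_r ∈ ℛ(K_r)` with `‖A - A_r‖ ≤ C_N r^{-N}` for all `N`. -/
def IsAlmostLocal (Q : QFT s m 𝔄 H) (A : H →L[ℂ] H) : Prop :=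
  ∃ a : ℝ → (H →L[ℂ] H), (∀ r, 0 < r → a r ∈ Q.localAlgebra (doubleCone s r)) ∧
    ∀ N : ℕ, ∃ C : ℝ, ∀ r, 0 < r → ‖A - a r‖ ≤ C * (r ^ N)⁻¹

/-- `A` is a creation operator. (In the main statement, `A = B*`.) -/
structure IsCreationOperator (Q : QFT s m 𝔄 H) (A : H →L[ℂ] H) : Prop where
  mem_globalAlgebra : A ∈ Q.globalAlgebra
  almostLocal : Q.IsAlmostLocal A
  isCompact_arvesonSpectrum : IsCompact (arvesonSpectrum Q.U A)
  arvesonSpectrum_subset : arvesonSpectrum Q.U A ⊆ forwardCone s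
  nonempty_inter : (arvesonSpectrum Q.U A ∩ jointSpectrum Q.U).Nonempty
  inter_subset : arvesonSpectrum Q.U A ∩ jointSpectrum Q.U ⊆ massHyperboloid s m

/-- The integrand `⟪e^{-itH} ψ, (B*B)(𝐱) e^{-itH} ψ⟫`, where `(B*B)(𝐱) = (B*B)(0, 𝐱)`. -/
def detectorDensity (Q : QFT s m 𝔄 H) (B : H →L[ℂ] H) (ψ : H) (t : ℝ)
    (x : EuclideanSpace ℝ (Fin s)) : ℂ :=
  ⟪timeEvolution Q.U t ψ, translate Q.U (star B * B) (0, x) (timeEvolution Q.U t ψ)⟫_ℂ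

end QFT

end

end HaagKastler

/-! A mass eigenvector `ψ` has its spectral measure on a single hyperboloid `p₀ = √(r² + |𝐩|²)`,
where the energy is a continuous function of the momentum. Since the momenta in `Δ` are bounded,
Stone–Weierstrass approximates `e^{-itp₀}` uniformly by trigonometric polynomials in `𝐩`. Hence `V
ψ`, with `V = e^{-itH}`, is a norm limit of vectors `T ψ`, with `T` a linear combination of spatial
translations (`exists_spaceTranslation_near`).

The form `F(φ, χ) = ∫ ⟪B(𝐱)φ, B(𝐱)χ⟫ d𝐱` is invariant under spatial translations, so `F(Tφ, χ) =
F(φ, T*χ)`. Thus `F(Vψ, Vψ) ≈ F(Tψ, Vψ) = F(ψ, T*Vψ) ≈ F(ψ, ψ)`. The last step uses `T*Vψ - ψ = V(T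
- V)*ψ`, whose norm equals `‖(T - V)ψ‖` because `T - V` is normal
(`IsSquareIntegrableOn.detectorForm_eq`).

The approximation requires `F` to be bounded. Every element of `σ_α(B*)` has energy at least some `ε
> 0`, so `B` lowers the energy by at least `ε`, and products of sufficiently many translates of `B`
annihilate `ψ` (`VecSpec.mem_annihilated`). Almost locality makes `‖[B, B*(𝐳)]‖` integrable in `𝐳`,
and an induction on the number of factors then bounds `∫ ‖B(𝐱)φ‖² d𝐱` by a multiple of `‖φ‖²`
(`integral_closedBall_norm_sq_le`). The induction runs over the translation-invariant subspaces
`annihilated U B n`, so no spectral projections are needed.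

Spectral supports are handled by pairing matrix elements with Fourier transforms of test functions
(`SpecIn`, `VecSpec`). The additivity of energy-momentum transfer rests on `SpecIn.diag`. -/

namespace HaagKastler

noncomputable section

open Filter Topology FourierTransform

variable {s : ℕ}

/-! ### Plane waves and Fourier transforms of test functions -/

lemma minkowski_comm (p x : Spacetime s) : minkowski p x = minkowski x p := by
  simp only [minkowski, real_inner_comm, mul_comm]

lemma minkowski_add_left (p q x : Spacetime s) :
    minkowski (p + q) x = minkowski p x + minkowski q x := by
  simp only [minkowski, Prod.fst_add, Prod.snd_add, inner_add_left]; ring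

lemma minkowski_neg_left (p x : Spacetime s) : minkowski (-p) x = -minkowski p x := by
  simp only [minkowski, Prod.fst_neg, Prod.snd_neg, inner_neg_left]; ring

lemma planeWave_comm (p x : Spacetime s) : planeWave p x = planeWave x p := by
  simp only [planeWave, minkowski_comm]

lemma planeWave_add_left (p q x : Spacetime s) :
    planeWave (p + q) x = planeWave p x * planeWave q x := by
  simp only [planeWave, minkowski_add_left, ← Complex.exp_add]; push_cast; ring_nf

lemma planeWave_add_right (p x y : Spacetime s) :
    planeWave p (x + y) = planeWave p x * planeWave p y := by
  rw [planeWave_comm, planeWave_add_left, planeWave_comm x, planeWave_comm y]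

@[simp] lemma planeWave_zero_left (x : Spacetime s) : planeWave 0 x = 1 := by
  simp [planeWave, minkowski]

@[simp] lemma planeWave_zero_right (x : Spacetime s) : planeWave x 0 = 1 := by
  simp [planeWave, minkowski]

@[simp] lemma norm_planeWave (p x : Spacetime s) : ‖planeWave p x‖ = 1 := by
  rw [planeWave, mul_comm, Complex.norm_exp_ofReal_mul_I]

lemma planeWave_neg_right (p x : Spacetime s) : planeWave p (-x) = planeWave (-p) x := by
  rw [planeWave_comm, planeWave, planeWave, minkowski_neg_left, minkowski_neg_left,
    minkowski_comm]

lemma star_planeWave (p x : Spacetime s) :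
    (starRingEnd ℂ) (planeWave p x) = planeWave (-p) x := by
  rw [planeWave, planeWave, ← Complex.exp_conj, minkowski_neg_left]
  simp

lemma continuous_minkowski :
    Continuous fun z : Spacetime s × Spacetime s => minkowski z.1 z.2 := by
  unfold minkowski; fun_prop

lemma continuous_planeWave :
    Continuous fun z : Spacetime s × Spacetime s => planeWave z.1 z.2 := by
  unfold planeWave
  exact Complex.continuous_exp.comp
    (continuous_const.mul (Complex.continuous_ofReal.comp continuous_minkowski))

lemma continuous_planeWave_left (x : Spacetime s) : Continuous fun p => planeWave p x :=
  continuous_planeWave.comp (by fun_prop : Continuous fun p : Spacetime s => (p, x))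

lemma continuous_planeWave_right (p : Spacetime s) : Continuous fun x => planeWave p x :=
  continuous_planeWave.comp (by fun_prop : Continuous fun x : Spacetime s => (p, x))

lemma contDiff_planeWave_left (x : Spacetime s) : ContDiff ℝ ∞ fun p => planeWave p x := by
  unfold planeWave minkowski
  apply Complex.contDiff_exp.comp
  refine contDiff_const.mul (Complex.ofRealCLM.contDiff.comp ?_)
  exact (contDiff_fst.mul contDiff_const).sub (contDiff_snd.inner ℝ contDiff_const)

/-- Smooth functions of compact support. -/
structure IsTestFunction (g : Spacetime s → ℂ) : Prop where
  smooth : ContDiff ℝ ∞ g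
  compact : HasCompactSupport g

namespace IsTestFunction

variable {g h : Spacetime s → ℂ}

lemma integrable (hg : IsTestFunction g) : Integrable g :=
  hg.smooth.continuous.integrable_of_hasCompactSupport hg.compact

lemma mul_left (hg : IsTestFunction g) {f : Spacetime s → ℂ} (hf : ContDiff ℝ ∞ f) :
    IsTestFunction (fun p => f p * g p) :=
  ⟨hf.mul hg.smooth, hg.compact.mul_left⟩

lemma sub (hg : IsTestFunction g) (hh : IsTestFunction h) : IsTestFunction (fun p => g p - h p) :=
  ⟨hg.smooth.sub hh.smooth, hg.compact.sub hh.compact⟩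

end IsTestFunction

/-- The Fourier transform `x ↦ ∫ g(p) e^{-i p · x} dp`. -/
def fourierInt (g : Spacetime s → ℂ) (x : Spacetime s) : ℂ := ∫ p, g p * planeWave (-p) x

/-- The Euclidean space underlying Minkowski space. -/
abbrev EuclideanSpacetime (s : ℕ) : Type := WithLp 2 (ℝ × EuclideanSpace ℝ (Fin s))

/-- The identification of Minkowski space with Euclidean space that turns the Minkowski product
into the Euclidean one. -/
def reflect (s : ℕ) : Spacetime s ≃L[ℝ] EuclideanSpacetime s :=
  ((ContinuousLinearEquiv.refl ℝ ℝ).prodCongr (ContinuousLinearEquiv.neg ℝ)).trans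
    (WithLp.prodContinuousLinearEquiv 2 ℝ ℝ (EuclideanSpace ℝ (Fin s))).symm

lemma measurePreserving_reflect : MeasurePreserving (reflect s) := by
  have h1 : MeasurePreserving (Prod.map id Neg.neg : Spacetime s → Spacetime s) :=
    (MeasurePreserving.id _).prod (Measure.measurePreserving_neg _)
  exact (WithLp.volume_preserving_toLp (U := ℝ) (V := EuclideanSpace ℝ (Fin s))).comp h1

lemma inner_reflect (p x : Spacetime s) :
    ⟪WithLp.toLp 2 p, reflect s x⟫_ℝ = minkowski p x := by
  simp [reflect, minkowski, WithLp.prod_inner_apply, mul_comm]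
  ring

/-- The factor `(2π)⁻¹` reconciles the kernel `e^{-ip·x}` with the kernel `e^{-2πi⟨v,w⟩}` of `𝓕`. -/
lemma fourierInt_eq (g : Spacetime s → ℂ) (x : Spacetime s) :
    fourierInt g x = 𝓕 (fun v : EuclideanSpacetime s => g (WithLp.ofLp v))
      ((2 * Real.pi)⁻¹ • reflect s x) := by
  have h2 : MeasurePreserving (WithLp.toLp 2 : Spacetime s → EuclideanSpacetime s) :=
    WithLp.volume_preserving_toLp (U := ℝ) (V := EuclideanSpace ℝ (Fin s))
  have h3 : MeasurableEmbedding (WithLp.toLp 2 : Spacetime s → EuclideanSpacetime s) :=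
    (WithLp.prodContinuousLinearEquiv 2 ℝ ℝ
      (EuclideanSpace ℝ (Fin s))).symm.toHomeomorph.measurableEmbedding
  rw [Real.fourier_eq', fourierInt, ← h2.integral_comp h3]
  congr 1; ext p
  rw [inner_smul_right, inner_reflect, planeWave, minkowski_neg_left, smul_eq_mul, mul_comm]
  congr 2
  push_cast
  field_simp

lemma IsTestFunction.exists_schwartz {g : Spacetime s → ℂ} (hg : IsTestFunction g) :
    ∃ f : SchwartzMap (EuclideanSpacetime s) ℂ, ∀ v, f v = g (WithLp.ofLp v) := by
  let e := WithLp.prodContinuousLinearEquiv 2 ℝ ℝ (EuclideanSpace ℝ (Fin s))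
  have h1 : HasCompactSupport (fun v : EuclideanSpacetime s => g (e v)) :=
    hg.compact.comp_homeomorph e.toHomeomorph
  exact ⟨h1.toSchwartzMap (hg.smooth.comp e.contDiff), fun v => rfl⟩

lemma two_pi_ne : (2 * Real.pi : ℂ) ≠ 0 := by
  simp [Real.pi_ne_zero]

lemma finrank_euclideanSpacetime : Module.finrank ℝ (EuclideanSpacetime s) = 1 + s := by
  rw [← (reflect s).toLinearEquiv.finrank_eq]
  simp

lemma continuous_fourierInt {g : Spacetime s → ℂ} (hg : IsTestFunction g) :
    Continuous (fourierInt g) := by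
  obtain ⟨f, hf⟩ := hg.exists_schwartz
  have : fourierInt g = fun x => (𝓕 f) ((2 * Real.pi)⁻¹ • reflect s x) := by
    ext x; rw [fourierInt_eq, SchwartzMap.fourier_coe]; simp only [← hf]
  rw [this]
  exact (𝓕 f).continuous.comp (by fun_prop)

lemma integrable_fourierInt {g : Spacetime s → ℂ} (hg : IsTestFunction g) :
    Integrable (fourierInt g) := by
  obtain ⟨f, hf⟩ := hg.exists_schwartz
  have : fourierInt g = fun x => (𝓕 f) ((2 * Real.pi)⁻¹ • reflect s x) := by
    ext x; rw [fourierInt_eq, SchwartzMap.fourier_coe]; simp only [← hf]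
  rw [this]
  have h1 : Integrable fun w => (𝓕 f) ((2 * Real.pi)⁻¹ • w) :=
    (𝓕 f).integrable.comp_smul (by positivity)
  exact (measurePreserving_reflect.integrable_comp_emb
    (reflect s).toHomeomorph.measurableEmbedding).2 h1

/-- Fourier inversion for test functions. -/
lemma integral_fourierInt_mul_planeWave {g : Spacetime s → ℂ} (hg : IsTestFunction g)
    (q : Spacetime s) :
    ∫ x, fourierInt g x * planeWave q x = (2 * Real.pi : ℂ) ^ (1 + s) * g q := by
  obtain ⟨f, hf⟩ := hg.exists_schwartz
  have h0 : (fun v : EuclideanSpacetime s => g (WithLp.ofLp v)) = f := by ext; rw [hf]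
  have h1 : 𝓕⁻ (𝓕 (f : EuclideanSpacetime s → ℂ)) (WithLp.toLp 2 q) = g q := by
    rw [f.continuous.fourierInv_fourier_eq f.integrable, hf]
    rw [← SchwartzMap.fourier_coe]; exact (𝓕 f).integrable
  let F : EuclideanSpacetime s → ℂ := fun w => 𝓕 (f : EuclideanSpacetime s → ℂ) w *
    Complex.exp (Complex.I * (2 * Real.pi * ⟪w, WithLp.toLp 2 q⟫_ℝ : ℝ))
  have h2 : ∀ x, fourierInt g x * planeWave q x = F ((2 * Real.pi)⁻¹ • reflect s x) := by
    intro x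
    simp only [F]
    rw [fourierInt_eq, h0, inner_smul_left, real_inner_comm, inner_reflect, planeWave]
    congr 3
    simp only [conj_trivial]
    push_cast
    field_simp
  simp_rw [h2]
  rw [measurePreserving_reflect.integral_comp
    (reflect s).toHomeomorph.measurableEmbedding (fun w => F ((2 * Real.pi)⁻¹ • w)),
    Measure.integral_comp_smul, finrank_euclideanSpacetime, ← h1, Real.fourierInv_eq']
  have h3 : (|(((2 * Real.pi)⁻¹ : ℝ) ^ (1 + s))⁻¹| : ℝ) = (2 * Real.pi) ^ (1 + s) := by
    rw [abs_of_pos (by positivity), inv_pow, inv_inv]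
  rw [h3, Complex.real_smul]
  push_cast
  congr 2
  ext w
  simp only [F]
  rw [smul_eq_mul, mul_comm, mul_comm Complex.I]
  push_cast
  rfl

/-! ### Bounded functions with prescribed Fourier support -/

instance isAddHaarMeasure_volume_spacetime :
    (volume : Measure (Spacetime s)).IsAddHaarMeasure :=
  inferInstanceAs ((volume : Measure ℝ).prod
    (volume : Measure (EuclideanSpace ℝ (Fin s)))).IsAddHaarMeasure

/-- Bounded continuous functions. -/
structure IsBddCont {Y : Type*} [TopologicalSpace Y] (F : Y → ℂ) : Prop where
  continuous : Continuous F
  bounded : ∃ M : ℝ, ∀ x, ‖F x‖ ≤ M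

lemma IsBddCont.comp {Y Z : Type*} [TopologicalSpace Y] [TopologicalSpace Z] {F : Y → ℂ}
    (hF : IsBddCont F) {f : Z → Y} (hf : Continuous f) : IsBddCont (fun z => F (f z)) :=
  ⟨hF.continuous.comp hf, hF.bounded.imp fun _ h z => h (f z)⟩

lemma IsBddCont.integrable_mul {Y : Type*} [TopologicalSpace Y] [MeasurableSpace Y]
    [OpensMeasurableSpace Y] {μ : Measure Y} {F f : Y → ℂ} (hF : IsBddCont F)
    [SecondCountableTopologyEither Y ℂ] (hf : Integrable f μ) :
    Integrable (fun x => f x * F x) μ := by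
  obtain ⟨M, hM⟩ := hF.bounded
  exact hf.mul_bdd hF.continuous.aestronglyMeasurable (Eventually.of_forall hM)

/-- The Fourier transform of the bounded function `F` vanishes outside `C`. -/
def SpecIn (F : Spacetime s → ℂ) (C : Set (Spacetime s)) : Prop :=
  ∀ g, IsTestFunction g → Disjoint (tsupport g) C → ∫ x, fourierInt g x * F x = 0

lemma integrable_mul_planeWave_neg {g : Spacetime s → ℂ} (hg : Integrable g) (x : Spacetime s) :
    Integrable fun p => g p * planeWave (-p) x :=
  IsBddCont.integrable_mul
    ⟨(continuous_planeWave_left x).comp continuous_neg, 1, by simp⟩ hg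

lemma fourierInt_sub {g h : Spacetime s → ℂ} (hg : IsTestFunction g) (hh : IsTestFunction h)
    (x : Spacetime s) :
    fourierInt (fun p => g p - h p) x = fourierInt g x - fourierInt h x := by
  simp only [fourierInt, sub_mul]
  exact integral_sub (integrable_mul_planeWave_neg hg.integrable x)
    (integrable_mul_planeWave_neg hh.integrable x)

lemma fourierInt_sum {ι : Type*} (t : Finset ι) {g : ι → Spacetime s → ℂ}
    (hg : ∀ i, IsTestFunction (g i)) (x : Spacetime s) :
    fourierInt (fun p => ∑ i ∈ t, g i p) x = ∑ i ∈ t, fourierInt (g i) x := by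
  simp only [fourierInt, Finset.sum_mul]
  exact integral_finsetSum _ fun i _ => integrable_mul_planeWave_neg (hg i).integrable x

lemma fourierInt_planeWave_mul (g : Spacetime s → ℂ) (x y : Spacetime s) :
    fourierInt (fun p => planeWave p y * g p) x = fourierInt g (x - y) := by
  simp only [fourierInt]
  congr 1; ext p
  rw [sub_eq_add_neg, planeWave_add_right, planeWave_neg_right, neg_neg]
  ring

lemma star_fourierInt (g : Spacetime s → ℂ) (x : Spacetime s) :
    (starRingEnd ℂ) (fourierInt g x) = fourierInt (fun p => (starRingEnd ℂ) (g (-p))) x := by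
  simp only [fourierInt, ← integral_conj, map_mul, star_planeWave, neg_neg]
  rw [← integral_neg_eq_self]

lemma fourierInt_comp_smul (g : Spacetime s → ℂ) {r : ℝ} (hr : 0 < r) (x : Spacetime s) :
    fourierInt (fun p => g (r⁻¹ • p)) x = (r : ℂ) ^ (1 + s) * fourierInt g (r • x) := by
  simp only [fourierInt]
  have h := Measure.integral_comp_inv_smul (volume : Measure (Spacetime s))
    (fun p => g p * planeWave (-p) (r • x)) r
  have h2 : ∀ p : Spacetime s, planeWave (-(r⁻¹ • p)) (r • x) = planeWave (-p) x := by
    intro p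
    rw [planeWave, planeWave, minkowski_neg_left, minkowski_neg_left]
    have : minkowski (r⁻¹ • p) (r • x) = minkowski p x := by
      simp only [minkowski, Prod.smul_fst, Prod.smul_snd, inner_smul_left, inner_smul_right,
        smul_eq_mul, conj_trivial]
      field_simp
    rw [this]
  simp only [h2] at h
  rw [h, abs_of_pos (by positivity), Complex.real_smul]
  simp

lemma exists_test_one {C U : Set (Spacetime s)} (hC : IsCompact C) (hU : IsOpen U) (h : C ⊆ U) :
    ∃ k : Spacetime s → ℂ, IsTestFunction k ∧ (∀ᶠ p in 𝓝ˢ C, k p = 1) ∧ tsupport k ⊆ U := by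
  obtain ⟨L, hL, hCL, hLU⟩ := exists_compact_between hC hU h
  obtain ⟨f, h1, h0, -⟩ := exists_contMDiffMap_one_nhds_of_subset_interior (n := ⊤)
    (modelWithCornersSelf ℝ (Spacetime s)) hC.isClosed hCL
  have hs : tsupport (fun p => (f p : ℂ)) ⊆ L := by
    refine closure_minimal (fun p hp => ?_) hL.isClosed
    by_contra hpL
    exact hp (by simp [h0 p hpL])
  refine ⟨fun p => (f p : ℂ), ⟨Complex.ofRealCLM.contDiff.comp f.contMDiff.contDiff,
    hL.of_isClosed_subset (isClosed_tsupport _) hs⟩, ?_, hs.trans hLU⟩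
  filter_upwards [h1] with p hp
  simp [hp]

/-- A smooth partition of unity splits `g` into finitely many test functions, each supported in one
of the sets `O`. This passes from the local vanishing that defines `fourierSupport` to vanishing on
its whole complement. -/
lemma integral_fourierInt_mul_eq_zero_of_local {F : Spacetime s → ℂ} (hF : IsBddCont F)
    {g : Spacetime s → ℂ} (hg : IsTestFunction g)
    (h : ∀ p ∈ tsupport g, ∃ O : Set (Spacetime s), IsOpen O ∧ p ∈ O ∧
      ∀ g' : Spacetime s → ℂ, IsTestFunction g' → tsupport g' ⊆ O →
        ∫ x, fourierInt g' x * F x = 0) :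
    ∫ x, fourierInt g x * F x = 0 := by
  choose! O hO hpO hOF using h
  obtain ⟨t, ht⟩ := hg.compact.elim_finite_subcover (fun p : tsupport g => O p)
    (fun p => hO p p.2) (fun p hp => Set.mem_iUnion.2 ⟨⟨p, hp⟩, hpO p hp⟩)
  obtain ⟨f, hf⟩ := SmoothPartitionOfUnity.exists_isSubordinate
    (modelWithCornersSelf ℝ (Spacetime s)) (isClosed_tsupport g) (fun p : t => O p.1)
    (fun p => hO p.1 p.1.2) (by simpa [Set.iUnion_subtype] using ht)
  have hsm : ∀ i, IsTestFunction (fun p => (f i p : ℂ) * g p) := fun i =>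
    hg.mul_left (Complex.ofRealCLM.contDiff.comp (f i).contMDiff.contDiff)
  have hsum : g = fun p => ∑ i, (f i p : ℂ) * g p := by
    ext p
    by_cases hp : p ∈ tsupport g
    · have := f.sum_eq_one hp
      rw [finsum_eq_sum_of_fintype] at this
      rw [← Finset.sum_mul, ← Complex.ofReal_sum, this]; simp
    · simp [image_eq_zero_of_notMem_tsupport hp]
  have h1 : ∀ x, fourierInt g x * F x =
      ∑ i, fourierInt (fun p => (f i p : ℂ) * g p) x * F x := by
    intro x
    conv_lhs => rw [hsum]
    rw [fourierInt_sum _ hsm, Finset.sum_mul]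
  simp_rw [h1]
  rw [integral_finsetSum _ fun i _ => hF.integrable_mul (integrable_fourierInt (hsm i))]
  refine Finset.sum_eq_zero fun i _ => hOF i.1 i.1.2 _ (hsm i) ?_
  refine ((tsupport_mul_subset_left).trans ?_).trans (hf i)
  exact closure_mono (fun p hp => by simpa using hp)

namespace SpecIn

variable {F : Spacetime s → ℂ} {C D : Set (Spacetime s)}

lemma inter (hF : IsBddCont F) (hC : IsClosed C) (hD : IsClosed D)
    (h1 : SpecIn F C) (h2 : SpecIn F D) : SpecIn F (C ∩ D) := by
  intro g hg hd
  refine integral_fourierInt_mul_eq_zero_of_local hF hg fun p hp => ?_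
  by_cases hpC : p ∈ C
  · refine ⟨Dᶜ, hD.isOpen_compl, fun hpD => Set.disjoint_left.1 hd hp ⟨hpC, hpD⟩,
      fun g' hg' hs => h2 g' hg' (Set.disjoint_left.2 fun q hq => hs hq)⟩
  · exact ⟨Cᶜ, hC.isOpen_compl, hpC,
      fun g' hg' hs => h1 g' hg' (Set.disjoint_left.2 fun q hq => hs hq)⟩

lemma translate (h : SpecIn F C) (y : Spacetime s) : SpecIn (fun x => F (x + y)) C := by
  intro g hg hd
  have h1 := h (fun p => planeWave p y * g p) (hg.mul_left (contDiff_planeWave_left y))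
    (hd.mono_left (tsupport_mul_subset_right))
  simp_rw [fourierInt_planeWave_mul] at h1
  rw [← h1, ← integral_add_right_eq_self (fun x => fourierInt g (x - y) * F x) y]
  simp

lemma conj (h : SpecIn F C) : SpecIn (fun x => (starRingEnd ℂ) (F x)) (-C) := by
  intro g hg hd
  have h1 := h (fun p => (starRingEnd ℂ) (g (-p)))
    ⟨Complex.conjCLE.contDiff.comp (hg.smooth.comp contDiff_neg),
      ((hg.compact.comp_homeomorph (Homeomorph.neg _)).comp_left (map_zero (starRingEnd ℂ)))⟩ ?_
  · simp_rw [← star_fourierInt] at h1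
    have h2 := congrArg (starRingEnd ℂ) h1
    rw [← integral_conj] at h2
    simpa using h2
  · have h3 : tsupport (fun p => (starRingEnd ℂ) (g (-p))) ⊆ -tsupport g := by
      refine closure_minimal (fun p hp => ?_) (isClosed_tsupport g).neg
      refine subset_tsupport _ ?_
      simpa using hp
    refine Set.disjoint_left.2 fun p hp hpC => Set.disjoint_left.1 hd (h3 hp) ?_
    simpa using hpC

/-- A bounded continuous function of compact Fourier support is reproduced by test functions that
equal `1` near the support. -/
lemma integral_eq (hF : IsBddCont F) (hC : IsCompact C) (h : SpecIn F C) {k : Spacetime s → ℂ}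
    (hk : IsTestFunction k) (hk1 : ∀ᶠ p in 𝓝ˢ C, k p = 1) :
    ∫ x, fourierInt k x * F x = (2 * Real.pi : ℂ) ^ (1 + s) * F 0 := by
  obtain ⟨b, hb, hb1, -⟩ := exists_test_one (isCompact_closedBall (0 : Spacetime s) 1)
    isOpen_univ (Set.subset_univ _)
  have hb0 : ∀ p : Spacetime s, ‖p‖ ≤ 1 → b p = 1 := fun p hp =>
    hb1.self_of_nhdsSet p (by simpa using hp)
  have hbr : ∀ r : ℝ, 0 < r → IsTestFunction fun p => b (r⁻¹ • p) := fun r hr =>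
    ⟨hb.smooth.comp (contDiff_const_smul _),
      hb.compact.comp_homeomorph (Homeomorph.smulOfNeZero r⁻¹ (inv_ne_zero hr.ne'))⟩
  obtain ⟨R, hR⟩ := hC.isBounded.subset_closedBall 0
  -- For large `r` both `k` and `b(r⁻¹ ·)` equal `1` near `C`, so their difference pairs to zero
  -- with `F`. The limit `r → ∞` then concentrates the rescaled kernel at the origin.
  have hev : ∀ᶠ r : ℝ in atTop,
      ∫ x, fourierInt b x * F (r⁻¹ • x) = ∫ x, fourierInt k x * F x := by
    filter_upwards [eventually_gt_atTop 0, eventually_gt_atTop R] with r hr hrR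
    have h1 := h _ ((hbr r hr).sub hk) ?_
    · simp_rw [fourierInt_sub (hbr r hr) hk, sub_mul] at h1
      rw [integral_sub (hF.integrable_mul (integrable_fourierInt (hbr r hr)))
        (hF.integrable_mul (integrable_fourierInt hk)), sub_eq_zero] at h1
      rw [← h1]
      simp_rw [fourierInt_comp_smul b hr]
      have h2 := Measure.integral_comp_smul (volume : Measure (Spacetime s))
        (fun x => fourierInt b x * F (r⁻¹ • x)) r
      rw [abs_of_pos (by positivity), Complex.real_smul] at h2
      have h3 : (r : ℂ) ^ (1 + s) ≠ 0 := by
        exact pow_ne_zero _ (by exact_mod_cast hr.ne')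
      simp_rw [mul_assoc]
      rw [integral_const_mul]
      simp only [smul_smul, inv_mul_cancel₀ hr.ne', one_smul] at h2
      rw [h2]
      simp only [Module.finrank_prod, Module.finrank_self, finrank_euclideanSpace,
        Fintype.card_fin]
      push_cast
      field_simp
    · rw [Set.disjoint_left]
      intro p hp hpC
      revert hp
      rw [imp_false, notMem_tsupport_iff_eventuallyEq]
      have hpr : ∀ᶠ q in 𝓝 p, ‖q‖ < r := by
        refine continuous_norm.continuousAt.eventually_lt continuousAt_const ?_
        exact lt_of_le_of_lt (by simpa using hR hpC) hrR
      filter_upwards [hpr, (eventually_nhdsSet_iff_forall.1 hk1) p hpC] with q hq hkq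
      rw [hkq, hb0 _ ?_]
      · simp
      · rw [norm_smul, norm_inv, Real.norm_of_nonneg hr.le, inv_mul_le_iff₀ hr]
        linarith
  have hlim : Tendsto (fun r : ℝ => ∫ x, fourierInt b x * F (r⁻¹ • x)) atTop
      (𝓝 (∫ x, fourierInt b x * F 0)) := by
    obtain ⟨M, hM⟩ := hF.bounded
    refine tendsto_integral_filter_of_dominated_convergence (fun x => ‖fourierInt b x‖ * M) ?_ ?_
      ((integrable_fourierInt hb).norm.mul_const M) ?_
    · exact Eventually.of_forall fun r => ((continuous_fourierInt hb).mul
        (hF.continuous.comp (continuous_const_smul _))).aestronglyMeasurable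
    · refine Eventually.of_forall fun r => Eventually.of_forall fun x => ?_
      rw [norm_mul]
      exact mul_le_mul_of_nonneg_left (hM _) (norm_nonneg _)
    · refine Eventually.of_forall fun x => Tendsto.const_mul _ ?_
      have h0 : Tendsto (fun r : ℝ => r⁻¹ • x) atTop (𝓝 ((0 : ℝ) • x)) :=
        tendsto_inv_atTop_zero.smul_const x
      rw [zero_smul] at h0
      exact (hF.continuous.tendsto 0).comp h0
  have h4 := tendsto_nhds_unique (tendsto_const_nhds.congr' (hev.mono fun _ h => h.symm)) hlim
  rw [h4, integral_mul_const]
  have h5 := integral_fourierInt_mul_planeWave hb 0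
  simp only [planeWave_zero_left, mul_one] at h5
  rw [h5, hb0 0 (by simp), mul_one]

lemma integral_translate_eq (hF : IsBddCont F) (hC : IsCompact C) (h : SpecIn F C)
    {k : Spacetime s → ℂ} (hk : IsTestFunction k) (hk1 : ∀ᶠ p in 𝓝ˢ C, k p = 1)
    (y : Spacetime s) :
    ∫ x, fourierInt k (x - y) * F x = (2 * Real.pi : ℂ) ^ (1 + s) * F y := by
  have := (h.translate y).integral_eq (hF.comp (continuous_add_const y)) hC hk hk1
  rw [zero_add] at this
  rw [← this, ← integral_add_right_eq_self (fun x => fourierInt k (x - y) * F x) y]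
  simp

lemma eq_zero (hF : IsBddCont F) (h : SpecIn F ∅) (y : Spacetime s) : F y = 0 := by
  have h0 : IsTestFunction (fun _ : Spacetime s => (0 : ℂ)) :=
    ⟨contDiff_const, HasCompactSupport.zero⟩
  -- The zero function equals `1` near the empty set, so it reproduces `F`.
  have := h.integral_translate_eq hF isCompact_empty h0 (by simp) y
  simpa [fourierInt, two_pi_ne] using this.symm

end SpecIn

/-- The reproducing kernel decouples the two arguments of `G`: on the right `v` no longer depends on
`x`, so spectral information on the first argument can be used at fixed `v`. -/
lemma mul_integral_diag {a : Spacetime s → ℂ} (ha : Integrable a)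
    {G : Spacetime s → Spacetime s → ℂ} (hG : IsBddCont (Function.uncurry G))
    {C : Set (Spacetime s)} (hC : IsCompact C) (h : ∀ x, SpecIn (G x) C)
    {k : Spacetime s → ℂ} (hk : IsTestFunction k) (hk1 : ∀ᶠ p in 𝓝ˢ C, k p = 1) :
    (2 * Real.pi : ℂ) ^ (1 + s) * ∫ x, a x * G x x =
      ∫ v, ∫ x, a x * fourierInt k (v - x) * G x v := by
  have h1 : ∀ x, (2 * Real.pi : ℂ) ^ (1 + s) * (a x * G x x) =
      ∫ v, a x * fourierInt k (v - x) * G x v := by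
    intro x
    have hGx : IsBddCont (G x) := hG.comp (f := fun y => (x, y)) (by fun_prop)
    have := (h x).integral_translate_eq hGx hC hk hk1 x
    simp_rw [mul_assoc]
    rw [integral_const_mul, this]
    ring
  rw [← integral_const_mul]
  simp_rw [h1]
  refine integral_integral_swap ?_
  have h2 := (ha.convolution_integrand (ContinuousLinearMap.mul ℝ ℂ) (integrable_fourierInt hk)).swap
  exact hG.integrable_mul h2

lemma integral_mul_fourierInt_sub {f k : Spacetime s → ℂ} (hf : Integrable f)
    (hk : Integrable k) (u : Spacetime s) :
    ∫ x, f x * fourierInt k (u - x) =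
      ∫ p, k p * planeWave (-p) u * ∫ x, f x * planeWave p x := by
  have h1 : ∀ x, f x * fourierInt k (u - x) =
      ∫ p, f x * k p * (planeWave (-p) u * planeWave p x) := by
    intro x
    simp_rw [mul_assoc]
    rw [integral_const_mul, fourierInt]
    congr 2; ext p
    rw [sub_eq_add_neg, planeWave_add_right, planeWave_neg_right, neg_neg]
  simp_rw [h1]
  rw [integral_integral_swap]
  · congr 1; ext p
    rw [← integral_const_mul]
    congr 1; ext x
    ring
  · refine IsBddCont.integrable_mul (F := fun z : Spacetime s × Spacetime s =>
      planeWave (-z.2) u * planeWave z.2 z.1) ⟨?_, 1, ?_⟩ (hf.mul_prod hk)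
    · exact ((continuous_planeWave_left u).comp continuous_snd.neg).mul
        (continuous_planeWave.comp continuous_swap)
    · simp

/-- The Fourier support of the diagonal of a function of two variables. -/
lemma SpecIn.diag {G : Spacetime s → Spacetime s → ℂ} (hG : IsBddCont (Function.uncurry G))
    {C D : Set (Spacetime s)} (hC : IsCompact C) (hD : IsCompact D)
    (h1 : ∀ y, SpecIn (fun x => G x y) C) (h2 : ∀ x, SpecIn (G x) D) {K : Set (Spacetime s)}
    (hK : ∀ p ∈ C, ∀ q ∈ D, p + q ∈ K) : SpecIn (fun x => G x x) K := by
  intro g hg hd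
  -- By compactness, sums from small neighbourhoods of `C` and `D` still avoid the support of `g`.
  obtain ⟨U, V, hU, hV, hCU, hDV, hUV⟩ := generalized_tube_lemma hC hD
    (n := {z | z.1 + z.2 ∉ tsupport g})
    ((isClosed_tsupport g).isOpen_compl.preimage continuous_add)
    (fun z hz hzg => Set.disjoint_left.1 hd hzg (hK _ hz.1 _ hz.2))
  obtain ⟨k, hk, hk1, hkU⟩ := exists_test_one hC hU hCU
  obtain ⟨l, hl, hl1, hlV⟩ := exists_test_one hD hV hDV
  have hzero : ∀ p q, k p * (l q * g (p + q)) = 0 := by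
    intro p q
    by_cases hp : p ∈ tsupport k
    · by_cases hq : q ∈ tsupport l
      · have : (p, q) ∈ {z : Spacetime s × Spacetime s | z.1 + z.2 ∉ tsupport g} :=
          hUV ⟨hkU hp, hlV hq⟩
        simp [image_eq_zero_of_notMem_tsupport this]
      · simp [image_eq_zero_of_notMem_tsupport hq]
    · simp [image_eq_zero_of_notMem_tsupport hp]
  have hc : (2 * Real.pi : ℂ) ^ (1 + s) ≠ 0 := pow_ne_zero _ two_pi_ne
  have e1 := mul_integral_diag (integrable_fourierInt hg) hG hD h2 hl hl1
  have hbl : ∀ v, IsBddCont fun x => fourierInt l (v - x) := fun v =>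
    IsBddCont.comp ⟨continuous_fourierInt hl, ∫ p, ‖l p‖, fun x =>
      (norm_integral_le_integral_norm _).trans (by simp)⟩ (continuous_sub_left v)
  have ha : ∀ v, Integrable fun x => fourierInt g x * fourierInt l (v - x) := fun v =>
    (hbl v).integrable_mul (integrable_fourierInt hg)
  have e2 : ∀ v, ∫ x, fourierInt g x * fourierInt l (v - x) * G x v = 0 := by
    intro v
    have e3 := mul_integral_diag (ha v) (G := fun _ u => G u v)
      (hG.comp (f := fun z : Spacetime s × Spacetime s => (z.2, v)) (by fun_prop)) hC
      (fun _ => h1 v) hk hk1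
    -- After both decouplings the kernel is, up to a constant, the Fourier integral of `k(p) l(q)
    -- g(p + q)`, which vanishes by `hzero`.
    have e4 : ∀ u, ∫ x, fourierInt g x * fourierInt l (v - x) * fourierInt k (u - x) = 0 := by
      intro u
      rw [integral_mul_fourierInt_sub (ha v) hk.integrable]
      refine integral_eq_zero_of_ae (Eventually.of_forall fun p => ?_)
      have e5 : ∀ x, fourierInt g x * fourierInt l (v - x) * planeWave p x =
          fourierInt g x * planeWave p x * fourierInt l (v - x) := fun x => by ring
      simp_rw [e5]
      rw [integral_mul_fourierInt_sub _ hl.integrable, mul_assoc, mul_left_comm,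
        ← integral_const_mul]
      · simp_rw [mul_assoc, ← planeWave_add_left, integral_fourierInt_mul_planeWave hg]
        rw [integral_eq_zero_of_ae (Eventually.of_forall fun q => ?_)]
        · simp
        · have := hzero p q
          simp only [Pi.zero_apply]
          linear_combination (planeWave (-q) v * (2 * Real.pi : ℂ) ^ (1 + s)) * this
      · exact IsBddCont.integrable_mul ⟨continuous_planeWave_right p, 1, by simp⟩
          (integrable_fourierInt hg)
    simp_rw [integral_mul_const, e4] at e3
    simpa [hc] using e3
  simp_rw [e2] at e1
  simpa [hc] using e1

variable {H : Type*} [NormedAddCommGroup H] [InnerProductSpace ℂ H] [CompleteSpace H]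

/-! ### Strongly continuous representations of the translations -/

/-- Strongly continuous unitary representations of the translations. -/
structure IsTranslationRep (U : Spacetime s → unitary (H →L[ℂ] H)) : Prop where
  map_add : ∀ x y, U (x + y) = U x * U y
  continuous : ∀ φ : H, Continuous fun x => (U x : H →L[ℂ] H) φ

namespace IsTranslationRep

variable {U : Spacetime s → unitary (H →L[ℂ] H)} (hU : IsTranslationRep U)
include hU

lemma map_zero : U 0 = 1 := by
  have := hU.map_add 0 0
  rw [add_zero] at this
  exact (mul_eq_left.1 this.symm)

lemma apply_zero (φ : H) : (U 0 : H →L[ℂ] H) φ = φ := by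
  rw [hU.map_zero]; simp

lemma apply_apply (x y : Spacetime s) (φ : H) :
    (U x : H →L[ℂ] H) ((U y : H →L[ℂ] H) φ) = (U (x + y) : H →L[ℂ] H) φ := by
  rw [hU.map_add]; rfl

lemma star_eq (x : Spacetime s) : star (U x : H →L[ℂ] H) = (U (-x) : H →L[ℂ] H) := by
  have h : star (U x) = U (-x) := by
    rw [Unitary.star_eq_inv, inv_eq_iff_mul_eq_one, ← hU.map_add, add_neg_cancel, hU.map_zero]
  rw [← h]; rfl

omit hU in
lemma norm_apply (x : Spacetime s) (φ : H) : ‖(U x : H →L[ℂ] H) φ‖ = ‖φ‖ :=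
  Unitary.norm_map (U x) φ

lemma inner_apply_left (x : Spacetime s) (φ χ : H) :
    ⟪(U x : H →L[ℂ] H) φ, χ⟫_ℂ = ⟪φ, (U (-x) : H →L[ℂ] H) χ⟫_ℂ := by
  rw [← hU.star_eq, ContinuousLinearMap.star_eq_adjoint, ContinuousLinearMap.adjoint_inner_right]

omit hU in
lemma inner_translate_star_left (A : H →L[ℂ] H) (x : Spacetime s) (φ χ : H) :
    ⟪translate U (star A) x φ, χ⟫_ℂ = ⟪φ, translate U A x χ⟫_ℂ := by
  have : translate U (star A) x = star (translate U A x) := by simp [translate, mul_assoc]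
  rw [this, ContinuousLinearMap.star_eq_adjoint, ContinuousLinearMap.adjoint_inner_left]

omit hU in
lemma inner_apply_apply (x : Spacetime s) (φ χ : H) :
    ⟪(U x : H →L[ℂ] H) φ, (U x : H →L[ℂ] H) χ⟫_ℂ = ⟪φ, χ⟫_ℂ :=
  Unitary.inner_map_map (U x) φ χ

/-- The operators are isometries, so strong continuity upgrades to joint continuity. -/
lemma continuous_apply {Y : Type*} [TopologicalSpace Y] {f : Y → Spacetime s} {φ : Y → H}
    (hf : Continuous f) (hφ : Continuous φ) : Continuous fun y => (U (f y) : H →L[ℂ] H) (φ y) := by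
  refine continuous_iff_continuousAt.2 fun y₀ => ?_
  have h1 : Tendsto (fun y => (U (f y) : H →L[ℂ] H) (φ y₀)) (𝓝 y₀)
      (𝓝 ((U (f y₀) : H →L[ℂ] H) (φ y₀))) :=
    (((hU.continuous (φ y₀)).comp hf).tendsto y₀)
  have h2 : Tendsto (fun y => (U (f y) : H →L[ℂ] H) (φ y - φ y₀)) (𝓝 y₀) (𝓝 0) := by
    rw [tendsto_zero_iff_norm_tendsto_zero]
    simp only [norm_apply]
    have := ((hφ.sub continuous_const).norm : Continuous fun y => ‖φ y - φ y₀‖).tendsto y₀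
    simpa using this
  have := h2.add h1
  rw [zero_add] at this
  refine this.congr fun y => ?_
  rw [map_sub, sub_add_cancel]

lemma translate_apply (A : H →L[ℂ] H) (x : Spacetime s) (φ : H) :
    translate U A x φ = (U x : H →L[ℂ] H) (A ((U (-x) : H →L[ℂ] H) φ)) := by
  rw [translate, hU.star_eq]; rfl

lemma translate_zero (A : H →L[ℂ] H) : translate U A 0 = A := by
  ext φ; rw [hU.translate_apply, neg_zero, hU.apply_zero, hU.apply_zero]

lemma translate_mul (A B : H →L[ℂ] H) (x : Spacetime s) :
    translate U (A * B) x = translate U A x * translate U B x := by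
  ext φ
  simp [hU.translate_apply, hU.apply_apply, hU.apply_zero]

omit hU in
lemma translate_sub (A B : H →L[ℂ] H) (x : Spacetime s) :
    translate U (A - B) x = translate U A x - translate U B x := by
  simp [translate, mul_sub, sub_mul]

lemma translate_translate (A : H →L[ℂ] H) (x y : Spacetime s) :
    translate U (translate U A x) y = translate U A (y + x) := by
  ext φ
  simp only [hU.translate_apply, hU.apply_apply, neg_add_rev]

omit hU in
lemma norm_translate_le (A : H →L[ℂ] H) (x : Spacetime s) : ‖translate U A x‖ ≤ ‖A‖ := by
  rw [translate, ← Unitary.coe_star, CStarRing.norm_mul_coe_unitary,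
    CStarRing.norm_coe_unitary_mul]

lemma apply_translate (A : H →L[ℂ] H) (x y : Spacetime s) (φ : H) :
    (U y : H →L[ℂ] H) (translate U A x φ) = translate U A (y + x) ((U y : H →L[ℂ] H) φ) := by
  simp only [hU.translate_apply, hU.apply_apply, neg_add_rev, neg_add_cancel_right]

lemma continuous_translate (A : H →L[ℂ] H) {Y : Type*} [TopologicalSpace Y]
    {f : Y → Spacetime s} {φ : Y → H} (hf : Continuous f) (hφ : Continuous φ) :
    Continuous fun y => translate U A (f y) (φ y) := by
  simp only [hU.translate_apply]
  exact hU.continuous_apply hf (A.continuous.comp (hU.continuous_apply hf.neg hφ))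

lemma isBddCont_inner_translate (A : H →L[ℂ] H) (ψ φ : H) :
    IsBddCont fun z : Spacetime s × Spacetime s =>
      ⟪ψ, translate U A z.1 ((U z.2 : H →L[ℂ] H) φ)⟫_ℂ := by
  refine ⟨continuous_const.inner (hU.continuous_translate A continuous_fst
    (hU.continuous_apply continuous_snd continuous_const)), ‖ψ‖ * (‖A‖ * ‖φ‖), fun z => ?_⟩
  refine (norm_inner_le_norm _ _).trans (mul_le_mul_of_nonneg_left ?_ (norm_nonneg _))
  refine (ContinuousLinearMap.le_opNorm _ _).trans ?_
  rw [norm_apply]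
  exact mul_le_mul_of_nonneg_right (norm_translate_le A _) (norm_nonneg _)

lemma isBddCont_inner (ψ φ : H) :
    IsBddCont fun x : Spacetime s => ⟪ψ, (U x : H →L[ℂ] H) φ⟫_ℂ := by
  refine ⟨continuous_const.inner (hU.continuous φ), ‖ψ‖ * ‖φ‖, fun x => ?_⟩
  refine (norm_inner_le_norm _ _).trans ?_
  rw [norm_apply]

end IsTranslationRep

/-! ### Spectral supports of vectors -/

omit [CompleteSpace H] in
lemma isClosed_fourierSupport (F : Spacetime s → H →L[ℂ] H) : IsClosed (fourierSupport F) := by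
  rw [fourierSupport, isClosed_compl_iff, isOpen_iff_forall_mem_open]
  rintro p ⟨O, hO, hp, h⟩
  exact ⟨O, fun q hq => ⟨O, hO, hq, h⟩, hO, hp⟩

omit [CompleteSpace H] in
lemma specIn_fourierSupport {F : Spacetime s → H →L[ℂ] H} {ψ φ : H}
    (hF : IsBddCont fun x => ⟪ψ, F x φ⟫_ℂ) :
    SpecIn (fun x => ⟪ψ, F x φ⟫_ℂ) (fourierSupport F) := by
  intro g hg hd
  refine integral_fourierInt_mul_eq_zero_of_local hF hg fun p hp => ?_
  have hp' := Set.disjoint_left.1 hd hp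
  rw [fourierSupport, Set.notMem_compl_iff] at hp'
  obtain ⟨O, hO, hpO, h⟩ := hp'
  refine ⟨O, hO, hpO, fun g' hg' hs => ?_⟩
  have h1 := h g' hg'.smooth hg'.compact hs ψ φ
  rw [fourierPairing, mul_eq_zero] at h1
  exact h1.resolve_left (inv_ne_zero (pow_ne_zero _ two_pi_ne))

/-- The energy-momentum support of `φ` is contained in `C`. -/
def VecSpec (U : Spacetime s → unitary (H →L[ℂ] H)) (φ : H) (C : Set (Spacetime s)) : Prop :=
  ∀ χ : H, SpecIn (fun x => ⟪χ, (U x : H →L[ℂ] H) φ⟫_ℂ) C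

section

variable {U : Spacetime s → unitary (H →L[ℂ] H)} (hU : IsTranslationRep U)
include hU

lemma VecSpec.jointSpectrum (φ : H) : VecSpec U φ (jointSpectrum U) := fun χ =>
  specIn_fourierSupport (F := fun x => (U x : H →L[ℂ] H)) (hU.isBddCont_inner χ φ)

lemma VecSpec.apply {φ : H} {C : Set (Spacetime s)} (h : VecSpec U φ C) (y : Spacetime s) :
    VecSpec U ((U y : H →L[ℂ] H) φ) C := by
  intro χ
  have := h ((U (-y) : H →L[ℂ] H) χ)
  simp only [hU.inner_apply_left, neg_neg, hU.apply_apply] at this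
  simpa only [hU.apply_apply, add_comm y] using this

lemma VecSpec.eq_zero {φ : H} {C : Set (Spacetime s)} (h : VecSpec U φ C) (hC : IsClosed C)
    (hd : Disjoint C (HaagKastler.jointSpectrum U)) : φ = 0 := by
  have h1 : SpecIn (fun x => ⟪φ, (U x : H →L[ℂ] H) φ⟫_ℂ) ∅ := by
    have := (h φ).inter (hU.isBddCont_inner φ φ) hC (isClosed_fourierSupport _)
      (VecSpec.jointSpectrum hU φ φ)
    rw [HaagKastler.jointSpectrum, Set.disjoint_iff_inter_eq_empty] at hd
    rwa [hd] at this
  have h2 := h1.eq_zero (hU.isBddCont_inner φ φ) 0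
  simpa [hU.apply_zero] using h2

/-- The energy-momentum transfer of operators is additive. -/
lemma VecSpec.map {φ : H} {C : Set (Spacetime s)} (h : VecSpec U φ C) (hC : IsCompact C)
    {B : H →L[ℂ] H} (hB : IsCompact (arvesonSpectrum U (star B))) {K : Set (Spacetime s)}
    (hK : ∀ p ∈ arvesonSpectrum U (star B), ∀ q ∈ C, -p + q ∈ K) : VecSpec U (B φ) K := by
  intro χ
  -- Since `B(x) U(x) φ = U(x) B φ`, the function of interest is a diagonal. In the first variable
  -- its support lies in `-σ_α(B*)`, by complex conjugation; in the second it lies in `C`.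
  have h1 : SpecIn (fun x => ⟪χ, translate U B x ((U x : H →L[ℂ] H) φ)⟫_ℂ) K := by
    refine SpecIn.diag (G := fun x y => ⟪χ, translate U B x ((U y : H →L[ℂ] H) φ)⟫_ℂ)
      (hU.isBddCont_inner_translate B χ φ) hB.neg hC (fun y => ?_) (fun x => ?_)
      (fun p hp q hq => by simpa using hK (-p) hp q hq)
    · have h2 : IsBddCont fun x => ⟪(U y : H →L[ℂ] H) φ, translate U (star B) x χ⟫_ℂ := by
        have := (hU.isBddCont_inner_translate (star B) ((U y : H →L[ℂ] H) φ) χ).comp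
          (f := fun x => (x, 0)) (by fun_prop)
        simpa only [hU.apply_zero] using this
      have h3 := (specIn_fourierSupport h2).conj
      simp only [inner_conj_symm, IsTranslationRep.inner_translate_star_left] at h3
      exact h3
    · have h2 := h (translate U (star B) x χ)
      simp only [IsTranslationRep.inner_translate_star_left] at h2
      exact h2
  simpa only [hU.translate_apply, hU.apply_apply, neg_add_cancel, hU.apply_zero] using h1

lemma VecSpec.translate {φ : H} {C : Set (Spacetime s)} (h : VecSpec U φ C) (hC : IsCompact C)
    {B : H →L[ℂ] H} (hB : IsCompact (arvesonSpectrum U (star B))) {K : Set (Spacetime s)}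
    (hK : ∀ p ∈ arvesonSpectrum U (star B), ∀ q ∈ C, -p + q ∈ K) (x : Spacetime s) :
    VecSpec U (translate U B x φ) K := by
  rw [hU.translate_apply]
  exact ((h.apply hU (-x)).map hU hC hB hK).apply hU x

end

/-! ### Vectors annihilated by products of translates -/

/-- The vectors that are annihilated by all products of `n` translates of `B`. -/
def annihilated (U : Spacetime s → unitary (H →L[ℂ] H)) (B : H →L[ℂ] H) : ℕ → Submodule ℂ H
  | 0 => ⊥
  | n + 1 => ⨅ x, (annihilated U B n).comap (translate U B x : H →ₗ[ℂ] H)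

lemma mem_annihilated_succ {U : Spacetime s → unitary (H →L[ℂ] H)} {B : H →L[ℂ] H} {n : ℕ}
    {φ : H} : φ ∈ annihilated U B (n + 1) ↔ ∀ x, translate U B x φ ∈ annihilated U B n := by
  simp [annihilated]

lemma apply_mem_annihilated {U : Spacetime s → unitary (H →L[ℂ] H)} (hU : IsTranslationRep U)
    {B : H →L[ℂ] H} {n : ℕ} {φ : H} (hφ : φ ∈ annihilated U B n) (y : Spacetime s) :
    (U y : H →L[ℂ] H) φ ∈ annihilated U B n := by
  induction n generalizing φ with
  | zero => simp_all [annihilated]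
  | succ n ih =>
    rw [mem_annihilated_succ] at hφ ⊢
    intro x
    have := ih (hφ (-y + x))
    rwa [hU.apply_translate, add_neg_cancel_left] at this

/-- Operators that lower the energy annihilate vectors of bounded energy after finitely many
steps. -/
lemma VecSpec.mem_annihilated {U : Spacetime s → unitary (H →L[ℂ] H)} (hU : IsTranslationRep U)
    (hpos : ∀ p ∈ HaagKastler.jointSpectrum U, 0 ≤ p.1) {B : H →L[ℂ] H}
    (hB : IsCompact (arvesonSpectrum U (star B))) {ε : ℝ}
    (hε : ∀ p ∈ arvesonSpectrum U (star B), ε ≤ p.1) (n : ℕ) {lam : ℝ} (hlam : lam < n * ε)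
    {φ : H} {C : Set (Spacetime s)} (hC : IsCompact C) (hCl : ∀ p ∈ C, p.1 ≤ lam)
    (h : VecSpec U φ C) : φ ∈ annihilated U B n := by
  induction n generalizing lam φ C with
  | zero =>
    simp only [Nat.cast_zero, zero_mul] at hlam
    have : φ = 0 := h.eq_zero hU hC.isClosed (Set.disjoint_left.2 fun p hp hpj => by
      linarith [hCl p hp, hpos p hpj])
    simp [annihilated, this]
  | succ n ih =>
    rw [mem_annihilated_succ]
    intro x
    push_cast at hlam
    refine ih (lam := lam - ε) (by linarith)
      (C := (fun z : Spacetime s × Spacetime s => -z.1 + z.2) ''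
        (arvesonSpectrum U (star B) ×ˢ C)) ((hB.prod hC).image (continuous_fst.neg.add continuous_snd)) ?_
      (h.translate hU hC hB (fun p hp q hq => Set.mem_image_of_mem _ (Set.mk_mem_prod hp hq)) x)
    rintro _ ⟨⟨p, q⟩, ⟨hp, hq⟩, rfl⟩
    simp only [Prod.fst_neg, Prod.fst_add]
    linarith [hCl q hq, hε p hp]

/-! ### Spectral measures -/

namespace IsSpectralMeasure

variable {U : Spacetime s → unitary (H →L[ℂ] H)} {ψ : H} {μ : Measure (Spacetime s)}

lemma integral_fourierInt_mul_inner (hμ : IsSpectralMeasure U ψ μ) {g : Spacetime s → ℂ}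
    (hg : IsTestFunction g) :
    ∫ x, fourierInt g x * ⟪ψ, (U x : H →L[ℂ] H) ψ⟫_ℂ =
      (2 * Real.pi : ℂ) ^ (1 + s) * ∫ p, g p ∂μ := by
  have := hμ.finite
  simp_rw [hμ.inner_eq, ← integral_const_mul]
  rw [integral_integral_swap]
  · simp_rw [integral_fourierInt_mul_planeWave hg]
  · have h1 : Integrable (fun z : Spacetime s × Spacetime s => fourierInt g z.1 * (1 : ℂ))
        (volume.prod μ) := (integrable_fourierInt hg).mul_prod (integrable_const _)
    simp only [mul_one] at h1
    exact IsBddCont.integrable_mul (F := fun z : Spacetime s × Spacetime s => planeWave z.2 z.1)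
      ⟨continuous_planeWave.comp continuous_swap, 1, by simp⟩ h1

/-- The measure records only diagonal matrix elements. They show that `∫ ĝ(x) U(x)ψ dx` is
orthogonal to every `U(y)ψ`; being itself a superposition of these vectors, it vanishes, which
settles all `χ`. -/
lemma vecSpec (hU : IsTranslationRep U) (hμ : IsSpectralMeasure U ψ μ) {C : Set (Spacetime s)}
    (hC : μ Cᶜ = 0) : VecSpec U ψ C := by
  intro χ g hg hd
  have hint : Integrable fun x => fourierInt g x • (U x : H →L[ℂ] H) ψ :=
    (integrable_fourierInt hg).smul_bdd ‖ψ‖ (hU.continuous ψ).aestronglyMeasurable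
      (Eventually.of_forall fun x => (IsTranslationRep.norm_apply x ψ).le)
  have hin : ∀ η : H, ⟪η, ∫ x, fourierInt g x • (U x : H →L[ℂ] H) ψ⟫_ℂ =
      ∫ x, fourierInt g x * ⟪η, (U x : H →L[ℂ] H) ψ⟫_ℂ := by
    intro η
    rw [← integral_inner hint]
    simp_rw [inner_smul_right]
  have h0 : ∀ y, ⟪(U y : H →L[ℂ] H) ψ, ∫ x, fourierInt g x • (U x : H →L[ℂ] H) ψ⟫_ℂ = 0 := by
    intro y
    have h1 := hμ.integral_fourierInt_mul_inner
      (hg.mul_left (contDiff_planeWave_left (-y)))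
    rw [integral_eq_zero_of_ae (μ := μ), mul_zero] at h1
    · rw [hin, ← h1]
      simp_rw [fourierInt_planeWave_mul, sub_neg_eq_add, hU.inner_apply_left, hU.apply_apply]
      rw [← integral_add_left_eq_self _ y]
      simp [add_comm]
    · rw [← mem_ae_iff] at hC
      filter_upwards [hC] with p hp
      rw [image_eq_zero_of_notMem_tsupport (f := g) (Set.disjoint_right.1 hd hp), mul_zero,
        Pi.zero_apply]
  have hv : ∫ x, fourierInt g x • (U x : H →L[ℂ] H) ψ = 0 := by
    rw [← inner_self_eq_zero (𝕜 := ℂ), hin]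
    refine integral_eq_zero_of_ae (Eventually.of_forall fun x => ?_)
    beta_reduce
    rw [Pi.zero_apply, ← inner_conj_symm, h0, _root_.map_zero, mul_zero]
  rw [← hin, hv, inner_zero_right]

/-- By inner regularity it suffices to treat compact `K ⊆ Cᶜ`, on which `μ` is tested with `|k|²`
for a cutoff `k` equal to `1` on `K`. This transfers support information between two spectral
measures of the same vector without invoking uniqueness. -/
lemma measure_compl_eq_zero (hμ : IsSpectralMeasure U ψ μ) {C : Set (Spacetime s)}
    (hC : IsClosed C) (h : SpecIn (fun x => ⟪ψ, (U x : H →L[ℂ] H) ψ⟫_ℂ) C) : μ Cᶜ = 0 := by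
  have := hμ.finite
  rw [hC.isOpen_compl.measure_eq_iSup_isCompact]
  simp only [ENNReal.iSup_eq_zero]
  intro K hKC hK
  obtain ⟨k, hk, hk1, hks⟩ := exists_test_one hK hC.isOpen_compl hKC
  have hkk : IsTestFunction fun p => (starRingEnd ℂ) (k p) * k p :=
    hk.mul_left (Complex.conjCLE.contDiff.comp hk.smooth)
  have h1 := h _ hkk (Set.disjoint_left.2 fun p hp => hks (tsupport_mul_subset_right hp))
  rw [hμ.integral_fourierInt_mul_inner hkk, mul_eq_zero] at h1
  have h2 := h1.resolve_left (pow_ne_zero _ two_pi_ne)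
  have h3 : ∀ p, (starRingEnd ℂ) (k p) * k p = ((‖k p‖ ^ 2 : ℝ) : ℂ) := fun p => by
    rw [Complex.conj_mul']; push_cast; rfl
  simp_rw [h3, integral_complex_ofReal] at h2
  rw [Complex.ofReal_eq_zero, integral_eq_zero_iff_of_nonneg (fun p => by positivity)] at h2
  · refine measure_mono_null (fun p hp => ?_) h2
    have : k p = 1 := hk1.self_of_nhdsSet p hp
    simp [this]
  · have hc : Continuous fun p => ‖k p‖ ^ 2 := hk.smooth.continuous.norm.pow 2
    refine hc.integrable_of_hasCompactSupport ?_
    exact hk.compact.norm.comp_left (g := fun r : ℝ => r ^ 2) (by simp)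

end IsSpectralMeasure

/-! ### Decay of commutators -/

lemma mem_generatedVonNeumann {S : Set (H →L[ℂ] H)} {T : H →L[ℂ] H} :
    T ∈ generatedVonNeumann S ↔
      ∀ g ∈ StarSubalgebra.centralizer ℂ S, g * T = T * g := by
  have h : T ∈ generatedVonNeumann S ↔ T ∈ StarSubalgebra.centralizer ℂ
    (StarSubalgebra.centralizer ℂ S : Set (H →L[ℂ] H)) := Iff.rfl
  rw [h, StarSubalgebra.mem_centralizer_iff]
  exact ⟨fun h g hg => (h g hg).1, fun h g hg => ⟨h g hg, h _ (star_mem hg)⟩⟩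

lemma commute_of_mem_generatedVonNeumann {S₁ S₂ : Set (H →L[ℂ] H)}
    (h : ∀ a ∈ S₁, ∀ b ∈ S₂, a * b = b * a) (hS : ∀ a ∈ S₁, star a ∈ S₁)
    {T₁ T₂ : H →L[ℂ] H} (h₁ : T₁ ∈ generatedVonNeumann S₁) (h₂ : T₂ ∈ generatedVonNeumann S₂) :
    T₁ * T₂ = T₂ * T₁ := by
  have h3 : ∀ a ∈ S₁, a ∈ StarSubalgebra.centralizer ℂ S₂ := by
    intro a ha
    rw [StarSubalgebra.mem_centralizer_iff]
    refine fun b hb => ⟨(h a ha b hb).symm, ?_⟩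
    have := congrArg star (h _ (hS a ha) b hb)
    simpa using this
  have h4 : T₂ ∈ StarSubalgebra.centralizer ℂ S₁ := by
    rw [StarSubalgebra.mem_centralizer_iff]
    exact fun a ha => ⟨mem_generatedVonNeumann.1 h₂ a (h3 a ha),
      mem_generatedVonNeumann.1 h₂ _ (h3 _ (hS a ha))⟩
  exact (mem_generatedVonNeumann.1 h₁ _ h4).symm

lemma isRegion_doubleCone (r : ℝ) : IsRegion (doubleCone s r) := by
  refine ⟨isOpen_lt (by fun_prop) continuous_const, ?_⟩
  refine (Metric.isBounded_ball (x := (0 : Spacetime s)) (r := r)).subset fun x hx => ?_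
  have hx' : |x.1| + ‖x.2‖ < r := hx
  rw [mem_ball_zero_iff, Prod.norm_def, Real.norm_eq_abs]
  exact max_lt (by linarith [norm_nonneg x.2]) (by linarith [abs_nonneg x.1])

lemma IsRegion.translate {O : Set (Spacetime s)} (hO : IsRegion O) (x : Spacetime s) :
    IsRegion ((fun y => y + x) '' O) := by
  refine ⟨(Homeomorph.addRight x).isOpenMap _ hO.1, ?_⟩
  obtain ⟨R, hR⟩ := hO.2.exists_norm_le
  refine isBounded_iff_forall_norm_le.2 ⟨R + ‖x‖, ?_⟩
  rintro _ ⟨y, hy, rfl⟩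
  exact (norm_add_le _ _).trans (by linarith [hR y hy])

lemma translate_doubleCone_subset {r : ℝ} {z : EuclideanSpace ℝ (Fin s)} (hz : 2 * r ≤ ‖z‖) :
    (fun y => y + ((0 : ℝ), z)) '' doubleCone s r ⊆ causalComplement (doubleCone s r) := by
  rintro _ ⟨w, hw, rfl⟩ x hx
  have hw' : |w.1| + ‖w.2‖ < r := hw
  have hx' : |x.1| + ‖x.2‖ < r := hx
  simp only [Prod.fst_add, Prod.snd_add, add_zero]
  have h1 : |w.1 - x.1| ≤ |w.1| + |x.1| := abs_sub _ _
  have h2 : ‖z‖ ≤ ‖w.2 + z - x.2‖ + (‖w.2‖ + ‖x.2‖) := by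
    have : z = (w.2 + z - x.2) - (w.2 - x.2) := by abel
    calc ‖z‖ = ‖(w.2 + z - x.2) - (w.2 - x.2)‖ := by rw [← this]
      _ ≤ _ := (norm_sub_le _ _).trans (by gcongr; exact norm_sub_le _ _)
  rw [← sq_abs (w.1 - x.1)]
  exact pow_lt_pow_left₀ (by linarith) (abs_nonneg _) two_ne_zero

namespace QFT

variable {m : ℝ} {𝔄 : Type*} [CStarAlgebra 𝔄] (Q : QFT s m 𝔄 H)

lemma isTranslationRep : IsTranslationRep Q.U := ⟨Q.U_add, Q.U_continuous⟩

lemma translate_mem_localAlgebra {O : Set (Spacetime s)} (hO : IsRegion O) (x : Spacetime s)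
    {T : H →L[ℂ] H} (hT : T ∈ Q.localAlgebra O) :
    translate Q.U T x ∈ Q.localAlgebra ((fun y => y + x) '' O) := by
  have hU := Q.isTranslationRep
  refine mem_generatedVonNeumann.2 fun g hg => ?_
  have hback : ∀ A : H →L[ℂ] H, translate Q.U (translate Q.U A (-x)) x = A := fun A => by
    rw [hU.translate_translate, add_neg_cancel, hU.translate_zero]
  have h1 : translate Q.U g (-x) ∈ StarSubalgebra.centralizer ℂ (Q.π₀ '' (Q.net O : Set 𝔄)) := by
    rw [StarSubalgebra.mem_centralizer_iff] at hg ⊢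
    have key : ∀ b ∈ Q.net O, Q.π₀ b * translate Q.U g (-x) = translate Q.U g (-x) * Q.π₀ b := by
      intro b hb
      have h2 : Q.α x b ∈ (Q.net ((fun y => y + x) '' O) : Set 𝔄) := by
        rw [← Q.α_net O x hO]; exact ⟨b, hb, rfl⟩
      have h3 := (hg _ ⟨_, h2, rfl⟩).1
      rw [Q.covariance] at h3
      have h4 : translate Q.U (translate Q.U (Q.π₀ b) x) (-x) = Q.π₀ b := by
        rw [hU.translate_translate, neg_add_cancel, hU.translate_zero]
      have h5 := congrArg (fun T => translate Q.U T (-x)) h3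
      simpa only [hU.translate_mul, h4] using h5
    rintro _ ⟨b, hb, rfl⟩
    exact ⟨key b hb, by rw [← map_star]; exact key _ (star_mem hb)⟩
  have h2 := congrArg (fun A => translate Q.U A x) (mem_generatedVonNeumann.1 hT _ h1)
  simpa only [hU.translate_mul, hback] using h2

lemma commute_translate {r : ℝ} {z : EuclideanSpace ℝ (Fin s)} (hz : 2 * r ≤ ‖z‖)
    {A B : H →L[ℂ] H} (hA : A ∈ Q.localAlgebra (doubleCone s r))
    (hB : B ∈ Q.localAlgebra (doubleCone s r)) :
    translate Q.U A (0, z) * B = B * translate Q.U A (0, z) := by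
  refine commute_of_mem_generatedVonNeumann ?_ ?_
    (Q.translate_mem_localAlgebra (isRegion_doubleCone r) (0, z) hA) hB
  · rintro _ ⟨a, ha, rfl⟩ _ ⟨b, hb, rfl⟩
    rw [← map_mul, ← map_mul, Q.microcausality _ _ ((isRegion_doubleCone r).translate _)
      (isRegion_doubleCone r) (translate_doubleCone_subset hz) a ha b hb]
  · rintro _ ⟨a, ha, rfl⟩
    exact ⟨star a, star_mem ha, map_star _ _⟩

variable {Q} in
/-- The commutator of an almost local operator with the adjoint of its translate is dominated by
an integrable function. -/
lemma IsAlmostLocal.exists_commutator_bound {B : H →L[ℂ] H} (hB : Q.IsAlmostLocal (star B)) :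
    ∃ g : EuclideanSpace ℝ (Fin s) → ℝ, Continuous g ∧ Integrable g ∧ (∀ z, g (-z) = g z) ∧
      ∀ z, ‖B * translate Q.U (star B) (0, z) - translate Q.U (star B) (0, z) * B‖ ≤ g z := by
  obtain ⟨a, ha, hdec⟩ := hB
  -- Exponent `0` bounds the approximants uniformly; exponent `s + 1` gives decay integrable over
  -- `ℝ^s`.
  obtain ⟨C₀, hC₀⟩ := hdec 0
  obtain ⟨C, hC⟩ := hdec (s + 1)
  have hC₀' : 0 ≤ C₀ := by simpa using (norm_nonneg _).trans (hC₀ 1 one_pos)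
  have hC' : 0 ≤ C := by simpa using (norm_nonneg _).trans (hC 1 one_pos)
  -- The first summand serves `‖z‖ ≥ 1`, where `1 + ‖z‖ ≤ 4r` for `r = ‖z‖ / 2`; the second serves
  -- `‖z‖ < 1`.
  let D : ℝ := 2 * C * (2 * ‖B‖ + C₀) * 4 ^ (s + 1) + 2 * ‖B‖ ^ 2 * 2 ^ (s + 1)
  refine ⟨fun z => D * (1 + ‖z‖) ^ (-((s + 1 : ℕ) : ℝ)), ?_, ?_, fun z => by simp, fun z => ?_⟩
  · refine continuous_const.mul ((continuous_const.add continuous_norm).rpow_const fun z => ?_)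
    exact Or.inl (add_pos_of_pos_of_nonneg one_pos (norm_nonneg z)).ne'
  · refine Integrable.const_mul (integrable_one_add_norm ?_) D
    rw [finrank_euclideanSpace, Fintype.card_fin]; exact_mod_cast Nat.lt_succ_self s
  · have hpos : 0 < 1 + ‖z‖ := by positivity
    simp only
    rw [Real.rpow_neg hpos.le, Real.rpow_natCast]
    have hBs : ‖star B‖ = ‖B‖ := norm_star B
    set A := translate Q.U (star B) (0, z) with hAdef
    have hA : ‖A‖ ≤ ‖B‖ := hBs ▸ IsTranslationRep.norm_translate_le (star B) _
    rcases lt_or_ge ‖z‖ 1 with hz | hz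
    · have h1 : ‖B * A - A * B‖ ≤ 2 * ‖B‖ ^ 2 := by
        have e1 : ‖B * A‖ ≤ ‖B‖ * ‖B‖ := (norm_mul_le _ _).trans (by gcongr)
        have e2 : ‖A * B‖ ≤ ‖B‖ * ‖B‖ := (norm_mul_le _ _).trans (by gcongr)
        linarith [norm_sub_le (B * A) (A * B)]
      have h2 : (1 + ‖z‖) ^ (s + 1) ≤ 2 ^ (s + 1) := by gcongr; linarith
      rw [← div_eq_mul_inv, le_div_iff₀ (by positivity)]
      calc ‖B * A - A * B‖ * (1 + ‖z‖) ^ (s + 1) ≤ 2 * ‖B‖ ^ 2 * 2 ^ (s + 1) := by gcongr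
        _ ≤ D := le_add_of_nonneg_left (by positivity)
    -- This is the largest radius for which `commute_translate` applies at distance `‖z‖`.
    · let r : ℝ := ‖z‖ / 2
      have hr : 0 < r := half_pos (one_pos.trans_le hz)
      let b := star (a r)
      have hb : star b = a r := star_star _
      let A' := translate Q.U (a r) (0, z)
      have hcomm : A' * b = b * A' :=
        Q.commute_translate (by simp [r]; linarith) (ha r hr) (star_mem (ha r hr))
      set δ := ‖star B - a r‖ with hδ
      have hδ1 : ‖B - b‖ = δ := by
        rw [← norm_star (B - b), star_sub, hb]
      have hδ2 : ‖A - A'‖ ≤ δ := by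
        rw [hAdef, ← IsTranslationRep.translate_sub]
        exact IsTranslationRep.norm_translate_le _ _
      have hδC₀ : δ ≤ C₀ := by simpa using hC₀ r hr
      have hδ0 : 0 ≤ δ := norm_nonneg _
      have hbn : ‖b‖ ≤ ‖B‖ + C₀ := by
        have : ‖b‖ ≤ ‖B‖ + ‖B - b‖ := by
          have := norm_sub_le B (B - b)
          simpa using this
        linarith
      have h1 : B * A - A * B = ((B - b) * A - A * (B - b)) + (b * (A - A') - (A - A') * b) := by
        have : b * (A - A') - (A - A') * b = b * A - A * b + (A' * b - b * A') := by noncomm_ring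
        rw [this, hcomm]; noncomm_ring
      have h2 : ‖B * A - A * B‖ ≤ 2 * δ * (2 * ‖B‖ + C₀) := by
        rw [h1]
        have e1 : ‖(B - b) * A‖ ≤ δ * ‖B‖ := (norm_mul_le _ _).trans (by rw [hδ1]; gcongr)
        have e2 : ‖A * (B - b)‖ ≤ ‖B‖ * δ := (norm_mul_le _ _).trans (by rw [hδ1]; gcongr)
        have e3 : ‖b * (A - A')‖ ≤ (‖B‖ + C₀) * δ := (norm_mul_le _ _).trans (by gcongr)
        have e4 : ‖(A - A') * b‖ ≤ δ * (‖B‖ + C₀) := (norm_mul_le _ _).trans (by gcongr)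
        linarith [norm_add_le ((B - b) * A - A * (B - b)) (b * (A - A') - (A - A') * b),
          norm_sub_le ((B - b) * A) (A * (B - b)), norm_sub_le (b * (A - A')) ((A - A') * b)]
      have h3 : δ * (1 + ‖z‖) ^ (s + 1) ≤ C * 4 ^ (s + 1) := by
        have e1 : (1 + ‖z‖) ^ (s + 1) ≤ (4 * r) ^ (s + 1) := by
          gcongr; simp only [r]; linarith
        calc δ * (1 + ‖z‖) ^ (s + 1) ≤ (C * (r ^ (s + 1))⁻¹) * (4 * r) ^ (s + 1) := by
              gcongr; exact hC r hr
          _ = C * 4 ^ (s + 1) := by rw [mul_pow]; field_simp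
      rw [← div_eq_mul_inv, le_div_iff₀ (by positivity)]
      calc ‖B * A - A * B‖ * (1 + ‖z‖) ^ (s + 1)
          ≤ 2 * δ * (2 * ‖B‖ + C₀) * (1 + ‖z‖) ^ (s + 1) := by gcongr
        _ = 2 * (2 * ‖B‖ + C₀) * (δ * (1 + ‖z‖) ^ (s + 1)) := by ring
        _ ≤ 2 * (2 * ‖B‖ + C₀) * (C * 4 ^ (s + 1)) := by gcongr
        _ = 2 * C * (2 * ‖B‖ + C₀) * 4 ^ (s + 1) := by ring
        _ ≤ D := le_add_of_nonneg_right (by positivity)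

end QFT

/-! ### Square integrability of the translates of a lowering operator -/

section

variable {U : Spacetime s → unitary (H →L[ℂ] H)} (hU : IsTranslationRep U) {B : H →L[ℂ] H}
  {g : EuclideanSpace ℝ (Fin s) → ℝ}
include hU

lemma norm_commutator_translate_le
    (hcomm : ∀ z, ‖B * translate U (star B) (0, z) - translate U (star B) (0, z) * B‖ ≤ g z)
    (x y : EuclideanSpace ℝ (Fin s)) :
    ‖translate U B (0, x) * translate U (star B) (0, y) -
      translate U (star B) (0, y) * translate U B (0, x)‖ ≤ g (y - x) := by
  have h : translate U (star B) (0, y) =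
      translate U (translate U (star B) (0, y - x)) (0, x) := by
    rw [hU.translate_translate]; simp
  rw [h, ← hU.translate_mul, ← hU.translate_mul, ← IsTranslationRep.translate_sub]
  exact (IsTranslationRep.norm_translate_le _ _).trans (hcomm _)

/-- Moving `B*(y)` to the left of `B(x)` leaves `⟪B(y)B(x)φ, B(x)B(y)φ⟫` and a commutator term. The
inequality `2ab ≤ a² + b²` makes both bounds symmetric in `x` and `y`. -/
lemma re_inner_translate_le
    (hcomm : ∀ z, ‖B * translate U (star B) (0, z) - translate U (star B) (0, z) * B‖ ≤ g z)
    (φ : H) (x y : EuclideanSpace ℝ (Fin s)) :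
    Complex.re ⟪translate U (star B) (0, x) (translate U B (0, x) φ),
        translate U (star B) (0, y) (translate U B (0, y) φ)⟫_ℂ ≤
      (‖translate U B (0, y) (translate U B (0, x) φ)‖ ^ 2 +
        ‖translate U B (0, x) (translate U B (0, y) φ)‖ ^ 2) / 2 +
      g (y - x) * (‖translate U B (0, x) φ‖ ^ 2 + ‖translate U B (0, y) φ‖ ^ 2) / 2 := by
  set a := translate U B (0, x)
  set b := translate U B (0, y)
  set b' := translate U (star B) (0, y) with hb'
  have h1 : ⟪translate U (star B) (0, x) (a φ), b' (b φ)⟫_ℂ =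
      ⟪b (a φ), a (b φ)⟫_ℂ + ⟪a φ, (a * b' - b' * a) (b φ)⟫_ℂ := by
    rw [IsTranslationRep.inner_translate_star_left]
    have h2 : ⟪b (a φ), a (b φ)⟫_ℂ = ⟪a φ, b' (a (b φ))⟫_ℂ := by
      rw [← inner_conj_symm, ← inner_conj_symm (a φ), hb',
        IsTranslationRep.inner_translate_star_left]
    rw [h2, ← inner_add_right]
    congr 1
    simp [a]
  rw [h1, Complex.add_re]
  have h3 : Complex.re ⟪b (a φ), a (b φ)⟫_ℂ ≤ (‖b (a φ)‖ ^ 2 + ‖a (b φ)‖ ^ 2) / 2 := by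
    have := (Complex.re_le_norm _).trans (norm_inner_le_norm (𝕜 := ℂ) (b (a φ)) (a (b φ)))
    nlinarith [sq_nonneg (‖b (a φ)‖ - ‖a (b φ)‖)]
  have h4 : Complex.re ⟪a φ, (a * b' - b' * a) (b φ)⟫_ℂ ≤
      g (y - x) * (‖a φ‖ ^ 2 + ‖b φ‖ ^ 2) / 2 := by
    have hg := norm_commutator_translate_le hU hcomm x y
    have hg0 : 0 ≤ g (y - x) := (norm_nonneg _).trans hg
    have e1 : ‖(a * b' - b' * a) (b φ)‖ ≤ g (y - x) * ‖b φ‖ :=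
      (ContinuousLinearMap.le_opNorm _ _).trans (by gcongr)
    have e2 := (Complex.re_le_norm _).trans
      (norm_inner_le_norm (𝕜 := ℂ) (a φ) ((a * b' - b' * a) (b φ)))
    have e3 : ‖a φ‖ * ‖(a * b' - b' * a) (b φ)‖ ≤ ‖a φ‖ * (g (y - x) * ‖b φ‖) := by gcongr
    nlinarith [mul_nonneg hg0 (sq_nonneg (‖a φ‖ - ‖b φ‖))]
  linarith

lemma continuous_translate_space (A : H →L[ℂ] H) {Y : Type*} [TopologicalSpace Y]
    {f : Y → EuclideanSpace ℝ (Fin s)} {φ : Y → H} (hf : Continuous f) (hφ : Continuous φ) :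
    Continuous fun y => translate U A (0, f y) (φ y) :=
  hU.continuous_translate A (continuous_const.prodMk hf) hφ

omit hU [CompleteSpace H] in
lemma integrable_restrict_closedBall {F : Type*} [NormedAddCommGroup F]
    {f : EuclideanSpace ℝ (Fin s) → F} (hf : Continuous f) (R : ℝ) :
    Integrable f (volume.restrict (Metric.closedBall 0 R)) :=
  hf.continuousOn.integrableOn_compact (isCompact_closedBall _ _)

/-- Buchholz's bound: the translates of `B` are square integrable on vectors that are annihilated
by products of `n` translates. -/
lemma integral_closedBall_norm_sq_le (hgc : Continuous g) (hgi : Integrable g)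
    (hge : ∀ z, g (-z) = g z)
    (hcomm : ∀ z, ‖B * translate U (star B) (0, z) - translate U (star B) (0, z) * B‖ ≤ g z)
    (n : ℕ) {φ : H} (hφ : φ ∈ annihilated U B n) (R : ℝ) :
    ∫ x in Metric.closedBall (0 : EuclideanSpace ℝ (Fin s)) R, ‖translate U B (0, x) φ‖ ^ 2 ≤
      n * (∫ z, g z) * ‖φ‖ ^ 2 := by
  induction n generalizing φ with
  | zero =>
    have : φ = 0 := by simpa [annihilated] using hφ
    simp [this]
  | succ n ih =>
    rw [mem_annihilated_succ] at hφ
    have hg0 : ∀ z, 0 ≤ g z := fun z => (norm_nonneg _).trans (hcomm z)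
    set ν := (volume : Measure (EuclideanSpace ℝ (Fin s))).restrict (Metric.closedBall 0 R)
    have hK : IsCompact (Metric.closedBall (0 : EuclideanSpace ℝ (Fin s)) R) :=
      isCompact_closedBall _ _
    have : IsFiniteMeasure ν := ⟨by simpa [ν] using hK.measure_lt_top⟩
    have hint1 : ∀ {f : EuclideanSpace ℝ (Fin s) → ℝ}, Continuous f → Integrable f ν :=
      fun hf => integrable_restrict_closedBall hf R
    have hint2 : ∀ {f : EuclideanSpace ℝ (Fin s) × EuclideanSpace ℝ (Fin s) → ℝ},
        Continuous f → Integrable f (ν.prod ν) := fun {f} hf => by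
      rw [Measure.prod_restrict]
      exact hf.continuousOn.integrableOn_compact (hK.prod hK)
    let b : EuclideanSpace ℝ (Fin s) → H := fun x => translate U B (0, x) φ
    have hb : Continuous b := continuous_translate_space hU B continuous_id continuous_const
    let v : EuclideanSpace ℝ (Fin s) → H := fun x => translate U (star B) (0, x) (b x)
    have hv : Continuous v := continuous_translate_space hU (star B) continuous_id hb
    -- With `V = ∫ B*(x)B(x)φ` over the ball, `I = Re ⟪φ, V⟫ ≤ ‖φ‖ ‖V‖`, while the commutator
    -- estimate and the induction hypothesis give `‖V‖² ≤ (n + 1) c I`. Cancelling one factor `I`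
    -- requires it to be finite, hence the restriction to a ball.
    set I := ∫ x, ‖b x‖ ^ 2 ∂ν with hI
    set c := ∫ z, g z
    let V := ∫ x, v x ∂ν
    have hinner : ∀ η : H, ⟪η, V⟫_ℂ = ∫ x, ⟪η, v x⟫_ℂ ∂ν := fun η =>
      (integral_inner (integrable_restrict_closedBall hv R) η).symm
    have hre : ∀ η : H, Complex.re ⟪η, V⟫_ℂ = ∫ x, Complex.re ⟪η, v x⟫_ℂ ∂ν := fun η => by
      rw [hinner]
      exact (integral_re (𝕜 := ℂ)
        (integrable_restrict_closedBall (continuous_const.inner hv) R)).symm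
    have hIV : I = Complex.re ⟪φ, V⟫_ℂ := by
      rw [hre]
      refine integral_congr_ae (Eventually.of_forall fun x => ?_)
      simp only [v, b]
      rw [← inner_conj_symm, IsTranslationRep.inner_translate_star_left, Complex.conj_re]
      exact (inner_self_eq_norm_sq (𝕜 := ℂ) _).symm
    have hvv : Continuous fun z : EuclideanSpace ℝ (Fin s) × EuclideanSpace ℝ (Fin s) =>
        Complex.re ⟪v z.1, v z.2⟫_ℂ :=
      Complex.continuous_re.comp ((hv.comp continuous_fst).inner (hv.comp continuous_snd))
    have hVV : ‖V‖ ^ 2 = ∫ z, Complex.re ⟪v z.1, v z.2⟫_ℂ ∂(ν.prod ν) := by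
      rw [integral_prod (fun z => Complex.re ⟪v z.1, v z.2⟫_ℂ) (hint2 hvv)]
      have : ‖V‖ ^ 2 = Complex.re ⟪V, V⟫_ℂ := (inner_self_eq_norm_sq (𝕜 := ℂ) _).symm
      rw [this, hre]
      refine integral_congr_ae (Eventually.of_forall fun x => ?_)
      simp only
      rw [← inner_conj_symm, Complex.conj_re, hre]
    let P : EuclideanSpace ℝ (Fin s) × EuclideanSpace ℝ (Fin s) → ℝ := fun z =>
      ‖translate U B (0, z.2) (b z.1)‖ ^ 2 + g (z.2 - z.1) * ‖b z.1‖ ^ 2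
    have hP : Continuous P :=
      ((continuous_translate_space hU B continuous_snd (hb.comp continuous_fst)).norm.pow 2).add
        ((hgc.comp (continuous_snd.sub continuous_fst)).mul
          ((hb.comp continuous_fst).norm.pow 2))
    have hPs : Continuous fun z : EuclideanSpace ℝ (Fin s) × EuclideanSpace ℝ (Fin s) => P z.swap := hP.comp continuous_swap
    have hle : ‖V‖ ^ 2 ≤ ∫ z, P z ∂(ν.prod ν) := by
      have h1 : ∫ z, P z ∂(ν.prod ν) = ∫ z, (P z + P z.swap) / 2 ∂(ν.prod ν) := by
        rw [integral_div, integral_add (hint2 hP) (hint2 (f := fun z => P z.swap) hPs),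
          integral_prod_swap]
        ring
      rw [hVV, h1]
      refine integral_mono (hint2 hvv)
        (hint2 ((hP.add hPs).div_const 2)) fun z => ?_
      have h2 := re_inner_translate_le hU hcomm φ z.1 z.2
      have h3 : g (z.1 - z.2) = g (z.2 - z.1) := by rw [← hge, neg_sub]
      simp only [P, Prod.fst_swap, Prod.snd_swap, h3, b, v] at h2 ⊢
      linarith
    have hPle : ∫ z, P z ∂(ν.prod ν) ≤ (n * c + c) * I := by
      rw [integral_prod _ (hint2 hP), hI, ← integral_const_mul]
      refine integral_mono (hint2 hP).integral_prod_left
        (hint1 (continuous_const.mul (hb.norm.pow 2))) fun x => ?_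
      simp only [P]
      have e1 : Integrable (fun y => ‖translate U B (0, y) (b x)‖ ^ 2) ν :=
        hint1 ((continuous_translate_space hU B continuous_id continuous_const).norm.pow 2)
      have e2 : Integrable (fun y => g (y - x) * ‖b x‖ ^ 2) ν :=
        hint1 ((hgc.comp (continuous_id.sub continuous_const)).mul continuous_const)
      rw [integral_add e1 e2, add_mul]
      -- The vector `B(x)φ` is annihilated by products of one translate fewer.
      refine add_le_add (ih (hφ _)) ?_
      rw [integral_mul_const]
      refine mul_le_mul_of_nonneg_right ?_ (by positivity)
      calc ∫ y, g (y - x) ∂ν ≤ ∫ y, g (y - x) :=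
            setIntegral_le_integral (hgi.comp_sub_right x) (Eventually.of_forall fun y => hg0 _)
        _ = c := integral_sub_right_eq_self g x
    have hI0 : 0 ≤ I := integral_nonneg fun x => by positivity
    have hc0 : 0 ≤ c := integral_nonneg hg0
    have hIle : I ≤ ‖φ‖ * ‖V‖ :=
      hIV ▸ (Complex.re_le_norm _).trans (norm_inner_le_norm _ _)
    change I ≤ _
    push_cast
    rcases hI0.eq_or_lt with h0 | h0
    · rw [← h0]; positivity
    · have h1 : I * I ≤ ‖φ‖ ^ 2 * ((n * c + c) * I) := by
        calc I * I ≤ (‖φ‖ * ‖V‖) * (‖φ‖ * ‖V‖) := by gcongr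
          _ = ‖φ‖ ^ 2 * ‖V‖ ^ 2 := by ring
          _ ≤ _ := by gcongr; exact hle.trans hPle
      have h2 : I * I ≤ ((n + 1) * c * ‖φ‖ ^ 2) * I := by linarith
      exact le_of_mul_le_mul_right h2 h0

lemma integrable_norm_sq_translate (hgc : Continuous g) (hgi : Integrable g)
    (hge : ∀ z, g (-z) = g z)
    (hcomm : ∀ z, ‖B * translate U (star B) (0, z) - translate U (star B) (0, z) * B‖ ≤ g z)
    (n : ℕ) {φ : H} (hφ : φ ∈ annihilated U B n) :
    Integrable (fun x : EuclideanSpace ℝ (Fin s) => ‖translate U B (0, x) φ‖ ^ 2) ∧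
      ∫ x : EuclideanSpace ℝ (Fin s), ‖translate U B (0, x) φ‖ ^ 2 ≤
        n * (∫ z, g z) * ‖φ‖ ^ 2 := by
  have hcover : AECover volume atTop
      (fun k : ℕ => Metric.closedBall (0 : EuclideanSpace ℝ (Fin s)) (k : ℝ)) :=
    aecover_closedBall tendsto_natCast_atTop_atTop
  have hb := fun k : ℕ => integral_closedBall_norm_sq_le hU hgc hgi hge hcomm n hφ k
  have hcont : Continuous fun x : EuclideanSpace ℝ (Fin s) => ‖translate U B (0, x) φ‖ ^ 2 :=
    (continuous_translate_space hU B continuous_id continuous_const).norm.pow 2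
  have hint := hcover.integrable_of_integral_bounded_of_nonneg_ae _
    (fun k => hcont.continuousOn.integrableOn_compact (isCompact_closedBall _ _))
    (Eventually.of_forall fun x => by positivity) (Eventually.of_forall hb)
  exact ⟨hint, le_of_tendsto' (hcover.integral_tendsto_of_countably_generated hint) hb⟩

end

/-! ### The integrated form -/

/-- The form `∫ ⟪B(𝐱) φ, B(𝐱) χ⟫ d𝐱`. -/
def detectorForm (U : Spacetime s → unitary (H →L[ℂ] H)) (B : H →L[ℂ] H) (φ χ : H) : ℂ :=
  ∫ x : EuclideanSpace ℝ (Fin s), ⟪translate U B (0, x) φ, translate U B (0, x) χ⟫_ℂ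

/-- The translates of `B` are uniformly square integrable on `W`. -/
def IsSquareIntegrableOn (U : Spacetime s → unitary (H →L[ℂ] H)) (B : H →L[ℂ] H)
    (W : Submodule ℂ H) (C : ℝ) : Prop :=
  ∀ φ ∈ W, Integrable (fun x : EuclideanSpace ℝ (Fin s) => ‖translate U B (0, x) φ‖ ^ 2) ∧
    ∫ x : EuclideanSpace ℝ (Fin s), ‖translate U B (0, x) φ‖ ^ 2 ≤ C * ‖φ‖ ^ 2

/-- The linear combinations of spatial translations. -/
def spaceTranslations (U : Spacetime s → unitary (H →L[ℂ] H)) : Submodule ℂ (H →L[ℂ] H) :=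
  Submodule.span ℂ (Set.range fun a : EuclideanSpace ℝ (Fin s) => (U (0, a) : H →L[ℂ] H))

section

variable {U : Spacetime s → unitary (H →L[ℂ] H)} {B : H →L[ℂ] H} {W : Submodule ℂ H} {C : ℝ}
  {φ χ δ : H}

lemma conj_detectorForm (φ χ : H) :
    (starRingEnd ℂ) (detectorForm U B φ χ) = detectorForm U B χ φ := by
  rw [detectorForm, ← integral_conj]
  simp [detectorForm]

variable (hU : IsTranslationRep U)
include hU

lemma IsSquareIntegrableOn.integrable_inner (hW : IsSquareIntegrableOn U B W C) (hφ : φ ∈ W)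
    (hχ : χ ∈ W) : Integrable fun x : EuclideanSpace ℝ (Fin s) =>
      ⟪translate U B (0, x) φ, translate U B (0, x) χ⟫_ℂ := by
  have hc : ∀ η : H, Continuous fun x : EuclideanSpace ℝ (Fin s) => translate U B (0, x) η :=
    fun η => continuous_translate_space hU B continuous_id continuous_const
  refine ((hW φ hφ).1.add (hW χ hχ).1).mono' ((hc φ).inner (hc χ)).aestronglyMeasurable
    (Eventually.of_forall fun x => (norm_inner_le_norm _ _).trans ?_)
  simp only [Pi.add_apply]
  nlinarith [sq_nonneg (‖translate U B (0, x) φ‖ - ‖translate U B (0, x) χ‖),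
    sq_nonneg ‖translate U B (0, x) φ‖, sq_nonneg ‖translate U B (0, x) χ‖]

lemma IsSquareIntegrableOn.detectorForm_add_left (hW : IsSquareIntegrableOn U B W C)
    (hφ : φ ∈ W) (hδ : δ ∈ W) (hχ : χ ∈ W) :
    detectorForm U B (φ + δ) χ = detectorForm U B φ χ + detectorForm U B δ χ := by
  simp only [detectorForm, map_add, inner_add_left]
  exact integral_add (hW.integrable_inner hU hφ hχ) (hW.integrable_inner hU hδ hχ)

lemma IsSquareIntegrableOn.detectorForm_add_right (hW : IsSquareIntegrableOn U B W C)
    (hφ : φ ∈ W) (hδ : δ ∈ W) (hχ : χ ∈ W) :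
    detectorForm U B φ (δ + χ) = detectorForm U B φ δ + detectorForm U B φ χ := by
  simp only [detectorForm, map_add, inner_add_right]
  exact integral_add (hW.integrable_inner hU hφ hδ) (hW.integrable_inner hU hφ hχ)

omit hU in
lemma detectorForm_smul_left (c : ℂ) (φ χ : H) :
    detectorForm U B (c • φ) χ = (starRingEnd ℂ) c * detectorForm U B φ χ := by
  simp only [detectorForm, map_smul, inner_smul_left, integral_const_mul]

omit hU in
lemma detectorForm_smul_right (c : ℂ) (φ χ : H) :
    detectorForm U B φ (c • χ) = c * detectorForm U B φ χ := by
  simp only [detectorForm, map_smul, inner_smul_right, integral_const_mul]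

omit hU in
-- The weighted inequality `ab ≤ η⁻¹a² + ηb²` takes the place of Cauchy–Schwarz and gives a bound
-- linear in `η`.
lemma IsSquareIntegrableOn.norm_detectorForm_le (hW : IsSquareIntegrableOn U B W C)
    (hC : 0 ≤ C) (hδ : δ ∈ W) (hχ : χ ∈ W) {η : ℝ} (hη : 0 < η) (hδη : ‖δ‖ ≤ η) :
    ‖detectorForm U B δ χ‖ ≤ C * (1 + ‖χ‖ ^ 2) * η := by
  have h1 : ‖detectorForm U B δ χ‖ ≤ ∫ x : EuclideanSpace ℝ (Fin s),
      (η⁻¹ * ‖translate U B (0, x) δ‖ ^ 2 + η * ‖translate U B (0, x) χ‖ ^ 2) := by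
    refine norm_integral_le_of_norm_le
      (((hW δ hδ).1.const_mul _).add ((hW χ hχ).1.const_mul _))
      (Eventually.of_forall fun x => (norm_inner_le_norm _ _).trans ?_)
    set a := ‖translate U B (0, x) δ‖
    set b := ‖translate U B (0, x) χ‖
    have h2 : a * b * η ≤ (η⁻¹ * a ^ 2 + η * b ^ 2) * η := by
      have : (η⁻¹ * a ^ 2 + η * b ^ 2) * η = a ^ 2 + (η * b) ^ 2 := by field_simp
      rw [this]
      nlinarith [sq_nonneg (a - η * b), sq_nonneg a, sq_nonneg (η * b)]
    exact le_of_mul_le_mul_right h2 hη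
  rw [integral_add ((hW δ hδ).1.const_mul _) ((hW χ hχ).1.const_mul _), integral_const_mul,
    integral_const_mul] at h1
  have h3 : η⁻¹ * ∫ x : EuclideanSpace ℝ (Fin s), ‖translate U B (0, x) δ‖ ^ 2 ≤
      η⁻¹ * (C * η ^ 2) := by
    gcongr
    exact (hW δ hδ).2.trans (by gcongr)
  have h4 : η * ∫ x : EuclideanSpace ℝ (Fin s), ‖translate U B (0, x) χ‖ ^ 2 ≤
      η * (C * ‖χ‖ ^ 2) := by
    gcongr
    exact (hW χ hχ).2
  have h5 : η⁻¹ * (C * η ^ 2) = C * η := by field_simp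
  linarith

lemma detectorForm_apply_apply (a : EuclideanSpace ℝ (Fin s)) (φ χ : H) :
    detectorForm U B ((U (0, a) : H →L[ℂ] H) φ) ((U (0, a) : H →L[ℂ] H) χ) =
      detectorForm U B φ χ := by
  have h1 : ∀ (x : EuclideanSpace ℝ (Fin s)) (η : H),
      translate U B (0, x + a) ((U (0, a) : H →L[ℂ] H) η) =
        (U (0, a) : H →L[ℂ] H) (translate U B (0, x) η) := by
    intro x η
    rw [hU.apply_translate, Prod.mk_add_mk, add_zero, add_comm a]
  rw [detectorForm, ← integral_add_right_eq_self _ a]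
  simp_rw [h1, IsTranslationRep.inner_apply_apply]
  rfl

lemma apply_mem_of_mem_spaceTranslations (hWU : ∀ φ ∈ W, ∀ x, (U x : H →L[ℂ] H) φ ∈ W)
    {T : H →L[ℂ] H} (hT : T ∈ spaceTranslations U) (hφ : φ ∈ W) :
    T φ ∈ W ∧ star T φ ∈ W := by
  induction hT using Submodule.span_induction with
  | mem T hT =>
    obtain ⟨a, rfl⟩ := hT
    simp only [hU.star_eq]
    exact ⟨hWU φ hφ _, hWU φ hφ _⟩
  | zero => simp
  | add S T _ _ hS hT => rw [star_add]; exact ⟨W.add_mem hS.1 hT.1, W.add_mem hS.2 hT.2⟩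
  | smul c T _ hT => rw [star_smul]; exact ⟨W.smul_mem _ hT.1, W.smul_mem _ hT.2⟩

/-- For a single translation this is invariance of the form under the inverse translation;
sesquilinearity extends it to the span. -/
lemma IsSquareIntegrableOn.detectorForm_spaceTranslation (hW : IsSquareIntegrableOn U B W C)
    (hWU : ∀ φ ∈ W, ∀ x, (U x : H →L[ℂ] H) φ ∈ W)
    {T : H →L[ℂ] H} (hT : T ∈ spaceTranslations U) (hφ : φ ∈ W) (hχ : χ ∈ W) :
    detectorForm U B (T φ) χ = detectorForm U B φ (star T χ) := by
  induction hT using Submodule.span_induction with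
  | mem T hT =>
    obtain ⟨a, rfl⟩ := hT
    simp only [hU.star_eq]
    have h0 : ((0 : ℝ), -a) + (0, a) = (0 : Spacetime s) := by ext <;> simp
    rw [← detectorForm_apply_apply hU (-a), hU.apply_apply, h0, hU.apply_zero]
    simp
  | zero => simp [detectorForm]
  | add S T hS hT ihS ihT =>
    have h1 := fun {η} => apply_mem_of_mem_spaceTranslations (φ := η) hU hWU hS
    have h2 := fun {η} => apply_mem_of_mem_spaceTranslations (φ := η) hU hWU hT
    rw [star_add, add_apply, add_apply,
      hW.detectorForm_add_left hU (h1 hφ).1 (h2 hφ).1 hχ,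
      hW.detectorForm_add_right hU hφ (h1 hχ).2 (h2 hχ).2, ihS, ihT]
  | smul c T _ ihT =>
    rw [star_smul, smul_apply, smul_apply, detectorForm_smul_left, detectorForm_smul_right, ihT]
    rfl

lemma commute_of_mem_spaceTranslations {T : H →L[ℂ] H} (hT : T ∈ spaceTranslations U)
    (x : Spacetime s) : Commute T (U x : H →L[ℂ] H) ∧ Commute (star T) (U x : H →L[ℂ] H) := by
  have h0 : ∀ x y, Commute (U x : H →L[ℂ] H) (U y : H →L[ℂ] H) := fun x y => by
    have : U x * U y = U y * U x := by rw [← hU.map_add, ← hU.map_add, add_comm]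
    exact congrArg Subtype.val this
  induction hT using Submodule.span_induction with
  | mem T hT =>
    obtain ⟨a, rfl⟩ := hT
    simp only [hU.star_eq]
    exact ⟨h0 _ _, h0 _ _⟩
  | zero => simp
  | add S T _ _ hS hT => rw [star_add]; exact ⟨hS.1.add_left hT.1, hS.2.add_left hT.2⟩
  | smul c T _ hT => rw [star_smul]; exact ⟨hT.1.smul_left _, hT.2.smul_left _⟩

lemma commute_star_of_mem_spaceTranslations {T : H →L[ℂ] H} (hT : T ∈ spaceTranslations U) :
    Commute T (star T) := by
  have key : ∀ S ∈ spaceTranslations U, Commute S (star T) := by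
    intro S hS
    induction hS using Submodule.span_induction with
    | mem S hS =>
      obtain ⟨a, rfl⟩ := hS
      exact (commute_of_mem_spaceTranslations hU hT _).2.symm
    | zero => simp
    | add S T _ _ hS hT => exact hS.add_left hT
    | smul c T _ hT => exact hT.smul_left _
  exact key T hT

/-- If `U(y) ψ` lies in the closed span of the spatial translates of `ψ`, then the detector form
takes the same value on `U(y) ψ` and on `ψ`. -/
lemma IsSquareIntegrableOn.detectorForm_eq (hW : IsSquareIntegrableOn U B W C) (hC : 0 ≤ C)
    (hWU : ∀ φ ∈ W, ∀ x, (U x : H →L[ℂ] H) φ ∈ W) {ψ : H} (hψ : ψ ∈ W) (y : Spacetime s)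
    (happ : ∀ η > 0, ∃ T ∈ spaceTranslations U, ‖T ψ - (U y : H →L[ℂ] H) ψ‖ ≤ η) :
    detectorForm U B ((U y : H →L[ℂ] H) ψ) ((U y : H →L[ℂ] H) ψ) = detectorForm U B ψ ψ := by
  set V := (U y : H →L[ℂ] H) with hV
  have hVψ : V ψ ∈ W := hWU ψ hψ y
  set K := C * (1 + ‖ψ‖ ^ 2) with hK
  have hK0 : 0 ≤ K := by positivity
  have hbound : ∀ η > 0, ‖detectorForm U B (V ψ) (V ψ) - detectorForm U B ψ ψ‖ ≤ 2 * K * η := by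
    intro η hη
    obtain ⟨T, hT, hTη⟩ := happ η hη
    have hTW := fun {φ} => apply_mem_of_mem_spaceTranslations (φ := φ) hU hWU hT
    have hδ₁ : V ψ - T ψ ∈ W := W.sub_mem hVψ (hTW hψ).1
    have hδ₂ : star T (V ψ) - ψ ∈ W := W.sub_mem (hTW hVψ).2 hψ
    have hcomm := commute_of_mem_spaceTranslations hU hT y
    have hVn : star V * V = 1 := by simp [V]
    have hVn' : V * star V = 1 := by simp [V]
    have hnormal : IsStarNormal (T - V) := by
      have h1 : Commute (star T) T := (commute_star_of_mem_spaceTranslations hU hT).symm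
      have h2 : Commute (star V) T := by
        simpa using (commute_star_star.2 hcomm.2).symm
      have h3 : Commute (star T) V := hcomm.2
      have h4 : Commute (star V) V := hVn.trans hVn'.symm
      refine ⟨?_⟩
      rw [star_sub]
      exact (h1.sub_right h3).sub_left (h2.sub_right h4)
    -- Normality turns the hypothesis on `(T - V)ψ` into the same bound for `(T - V)*ψ`.
    have hn₂ : ‖star T (V ψ) - ψ‖ ≤ η := by
      have h1 : star T (V ψ) - ψ = V (star (T - V) ψ) := by
        have h2 : star T * V - star V * V = V * star (T - V) := by
          rw [hcomm.2.eq, hVn, star_sub, mul_sub, hVn']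
        have h3 := congrArg (fun A : H →L[ℂ] H => A ψ) h2
        simpa [hVn] using h3
      rw [h1, hV, IsTranslationRep.norm_apply, ContinuousLinearMap.star_eq_adjoint,
        ← (ContinuousLinearMap.isStarNormal_iff_norm_eq_adjoint.1 hnormal ψ)]
      exact hTη
    have e1 : detectorForm U B (V ψ) (V ψ) =
        detectorForm U B (T ψ) (V ψ) + detectorForm U B (V ψ - T ψ) (V ψ) := by
      rw [← hW.detectorForm_add_left hU (hTW hψ).1 hδ₁ hVψ, add_sub_cancel]
    have e2 : detectorForm U B (T ψ) (V ψ) =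
        detectorForm U B ψ ψ + detectorForm U B ψ (star T (V ψ) - ψ) := by
      rw [hW.detectorForm_spaceTranslation hU hWU hT hψ hVψ,
        ← hW.detectorForm_add_right hU hψ hψ hδ₂, add_sub_cancel]
    have e3 : ‖detectorForm U B (V ψ - T ψ) (V ψ)‖ ≤ K * η := by
      have := hW.norm_detectorForm_le hC hδ₁ hVψ hη (by rwa [norm_sub_rev])
      rwa [hV, IsTranslationRep.norm_apply] at this
    have e4 : ‖detectorForm U B ψ (star T (V ψ) - ψ)‖ ≤ K * η := by
      rw [← conj_detectorForm, RCLike.norm_conj]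
      exact hW.norm_detectorForm_le hC hδ₂ hψ hη hn₂
    have e5 : detectorForm U B (V ψ) (V ψ) - detectorForm U B ψ ψ =
        detectorForm U B ψ (star T (V ψ) - ψ) + detectorForm U B (V ψ - T ψ) (V ψ) := by
      rw [e1, e2]; ring
    rw [e5]
    linarith [norm_add_le (detectorForm U B ψ (star T (V ψ) - ψ))
      (detectorForm U B (V ψ - T ψ) (V ψ))]
  rw [← sub_eq_zero, ← norm_le_zero_iff]
  refine le_of_forall_pos_le_add fun ε hε => ?_
  -- The added `1` keeps the denominator positive when `K = 0`.
  refine (hbound (ε / (2 * K + 1)) (by positivity)).trans ?_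
  rw [zero_add, mul_div_assoc', div_le_iff₀ (by positivity)]
  nlinarith

end

/-! ### Mass eigenvectors -/

open BoundedContinuousFunction in
-- Stone–Weierstrass: the characters span a star subalgebra that separates points, also after
-- restriction to `K`.
lemma exists_trigonometric_near {K : Set (EuclideanSpace ℝ (Fin s))} (hK : IsCompact K)
    {G : EuclideanSpace ℝ (Fin s) → ℂ} (hG : Continuous G) {η : ℝ} (hη : 0 < η) :
    ∃ (t : Finset (EuclideanSpace ℝ (Fin s))) (c : EuclideanSpace ℝ (Fin s) → ℂ),
      ∀ p ∈ K, ‖∑ a ∈ t, c a * Complex.exp (Complex.I * (⟪p, a⟫_ℝ : ℝ)) - G p‖ < η := by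
  have : CompactSpace K := isCompact_iff_compactSpace.1 hK
  let A₀ := (charPoly Real.continuous_probChar
    (L := innerₗ (EuclideanSpace ℝ (Fin s))) continuous_inner).map (toContinuousMapStarₐ ℂ)
  have hA₀ : A₀.SeparatesPoints :=
    separatesPoints_charPoly _ Real.probChar_ne_one _ fun v hv h => hv <| by
      simpa using congrArg (fun L => L v) h
  let r : C(K, EuclideanSpace ℝ (Fin s)) := ⟨Subtype.val, continuous_subtype_val⟩
  let A := A₀.map (ContinuousMap.compStarAlgHom' ℂ ℂ r)
  have hA : A.SeparatesPoints := by
    intro p q hpq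
    obtain ⟨_, ⟨f, hf, rfl⟩, hfpq⟩ := hA₀ (fun h => hpq (Subtype.ext h))
    exact ⟨_, ⟨_, ⟨f, hf, rfl⟩, rfl⟩, hfpq⟩
  have htop := ContinuousMap.starSubalgebra_topologicalClosure_eq_top_of_separatesPoints A hA
  let G' : C(K, ℂ) := ⟨fun p => G p, hG.comp continuous_subtype_val⟩
  have hG' : G' ∈ closure (A : Set C(K, ℂ)) := by
    have : G' ∈ A.topologicalClosure := htop ▸ StarSubalgebra.mem_top
    exact this
  obtain ⟨_, ⟨_, ⟨f, hf, rfl⟩, rfl⟩, hdist⟩ := Metric.mem_closure_iff.1 hG' η hη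
  obtain ⟨w, hw⟩ := (mem_charPoly f).1 hf
  refine ⟨w.coeff.support, w.coeff, fun p hp => ?_⟩
  have h1 := (ContinuousMap.dist_lt_iff hη).1 hdist ⟨p, hp⟩
  rw [dist_comm, dist_eq_norm] at h1
  have h2 := congrFun hw p
  simp only [Finsupp.sum, Real.probChar_apply, innerₗ_apply_apply] at h2
  simp_rw [mul_comm Complex.I]
  rw [← h2]
  exact h1

omit [CompleteSpace H] in
lemma inner_self_eq_ofReal (φ : H) : ⟪φ, φ⟫_ℂ = ((‖φ‖ ^ 2 : ℝ) : ℂ) := by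
  rw [inner_self_eq_norm_sq_to_K]; push_cast; rfl

namespace IsSpectralMeasure

variable {U : Spacetime s → unitary (H →L[ℂ] H)} {ψ : H} {μ : Measure (Spacetime s)}

lemma measureReal_univ (hU : IsTranslationRep U) (hμ : IsSpectralMeasure U ψ μ) :
    μ.real Set.univ = ‖ψ‖ ^ 2 := by
  have h := hμ.inner_eq 0
  simp only [hU.apply_zero, planeWave_zero_right, integral_const, inner_self_eq_ofReal,
    Complex.real_smul, mul_one] at h
  exact_mod_cast h.symm

/-- The isometry between the cyclic subspace of `ψ` and `L²(μ)`, on trigonometric polynomials; it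
converts approximation on the spectrum into approximation in `H`. -/
lemma norm_sum_sq (hU : IsTranslationRep U) (hμ : IsSpectralMeasure U ψ μ) {ι : Type*}
    (t : Finset ι) (c : ι → ℂ) (x : ι → Spacetime s) :
    ‖∑ i ∈ t, c i • (U (x i) : H →L[ℂ] H) ψ‖ ^ 2 =
      ∫ p, ‖∑ i ∈ t, c i * planeWave p (x i)‖ ^ 2 ∂μ := by
  have := hμ.finite
  have hint : ∀ y : Spacetime s, Integrable (fun p => planeWave p y) μ := fun y => by
    have h := IsBddCont.integrable_mul (μ := μ) (F := fun p => planeWave p y)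
      ⟨continuous_planeWave_left y, 1, by simp⟩ (integrable_const (1 : ℂ))
    simpa using h
  have h1 : ∀ i j, ⟪(U (x i) : H →L[ℂ] H) ψ, (U (x j) : H →L[ℂ] H) ψ⟫_ℂ =
      ∫ p, (starRingEnd ℂ) (planeWave p (x i)) * planeWave p (x j) ∂μ := by
    intro i j
    rw [hU.inner_apply_left, hU.apply_apply, hμ.inner_eq]
    simp_rw [planeWave_add_right, star_planeWave, planeWave_neg_right]
  have h2 : ((‖∑ i ∈ t, c i • (U (x i) : H →L[ℂ] H) ψ‖ ^ 2 : ℝ) : ℂ) =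
      ((∫ p, ‖∑ i ∈ t, c i * planeWave p (x i)‖ ^ 2 ∂μ : ℝ) : ℂ) := by
    rw [← integral_complex_ofReal, ← inner_self_eq_ofReal, sum_inner]
    push_cast
    simp_rw [← Complex.conj_mul', map_sum, Finset.sum_mul_sum, inner_sum, inner_smul_left,
      inner_smul_right, h1, map_mul]
    have hint2 : ∀ i j, Integrable (fun p => (starRingEnd ℂ) (c i) *
        (starRingEnd ℂ) (planeWave p (x i)) * (c j * planeWave p (x j))) μ := by
      intro i j
      have := (hint (-x i + x j)).const_mul ((starRingEnd ℂ) (c i) * c j)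
      refine this.congr (Eventually.of_forall fun p => ?_)
      simp only [planeWave_add_right, star_planeWave, planeWave_neg_right]
      ring
    rw [integral_finsetSum _ fun i _ => integrable_finsetSum _ fun j _ => hint2 i j]
    refine Finset.sum_congr rfl fun i _ => ?_
    rw [integral_finsetSum _ fun j _ => hint2 i j]
    refine Finset.sum_congr rfl fun j _ => ?_
    rw [← integral_const_mul, ← integral_const_mul]
    congr 1; ext p; ring
  exact_mod_cast h2

end IsSpectralMeasure

/-- The graph conditions give `∫ f dμ = c‖ψ‖²` (at `x = 0`) and `∫ |f|² dμ = |c|²‖ψ‖²`, so expanding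
the square yields `∫ |f - c|² dμ = 0`. -/
lemma ae_eq_of_mem_functionalCalculusGraph {U : Spacetime s → unitary (H →L[ℂ] H)}
    (hU : IsTranslationRep U) {f : Spacetime s → ℂ} {ψ : H} {c : ℂ}
    (h : (ψ, c • ψ) ∈ functionalCalculusGraph U f) :
    ∃ μ, IsSpectralMeasure U ψ μ ∧ ∀ᵐ p ∂μ, f p = c := by
  obtain ⟨μ, hμ, hf, hin, hnorm⟩ := h
  have := hμ.finite
  refine ⟨μ, hμ, ?_⟩
  have hf1 : Integrable f μ := hf.integrable (by norm_num)
  have h0 := hin 0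
  simp only [hU.apply_zero, planeWave_zero_right, one_mul, inner_smul_right,
    inner_self_eq_ofReal] at h0
  have hfsq : Integrable (fun p => ‖f p‖ ^ 2) μ := hf.integrable_norm_pow (by norm_num)
  have hre : Integrable (fun p => Complex.re ((starRingEnd ℂ) c * f p)) μ :=
    (hf1.const_mul _).re
  have hexp : ∀ p, ‖f p - c‖ ^ 2 = ‖f p‖ ^ 2 - 2 * Complex.re ((starRingEnd ℂ) c * f p) +
      ‖c‖ ^ 2 := by
    intro p
    simp only [← Complex.normSq_eq_norm_sq, Complex.normSq_apply, Complex.sub_re, Complex.sub_im,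
      Complex.mul_re, Complex.conj_re, Complex.conj_im]
    ring
  have hmid : Integrable (fun p => ‖f p‖ ^ 2 - 2 * Complex.re ((starRingEnd ℂ) c * f p)) μ :=
    hfsq.sub (hre.const_mul 2)
  have hzero : ∫ p, ‖f p - c‖ ^ 2 ∂μ = 0 := by
    simp_rw [hexp]
    rw [integral_add hmid (integrable_const _),
      integral_sub hfsq (hre.const_mul 2), integral_const_mul, integral_const,
      hμ.measureReal_univ hU, ← hnorm]
    have h1 : ∫ p, Complex.re ((starRingEnd ℂ) c * f p) ∂μ = ‖c‖ ^ 2 * ‖ψ‖ ^ 2 := by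
      have := integral_re (𝕜 := ℂ) (hf1.const_mul ((starRingEnd ℂ) c))
      simp only [RCLike.re_eq_complex_re] at this
      rw [this, integral_const_mul, ← h0, ← mul_assoc, Complex.conj_mul']
      norm_cast
    rw [h1, norm_smul, smul_eq_mul]
    ring
  have hint : Integrable (fun p => ‖f p - c‖ ^ 2) μ := by
    simp_rw [hexp]
    exact hmid.add (integrable_const _)
  rw [integral_eq_zero_iff_of_nonneg (fun p => by positivity) hint] at hzero
  filter_upwards [hzero] with p hp
  simpa [sub_eq_zero] using hp

lemma exists_spaceTranslation_near {U : Spacetime s → unitary (H →L[ℂ] H)}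
    (hU : IsTranslationRep U) {ψ : H} {μ : Measure (Spacetime s)} (hμ : IsSpectralMeasure U ψ μ)
    {Δ : Set (Spacetime s)} (hΔ : IsCompact Δ) (hμΔ : μ Δᶜ = 0) {r : ℝ}
    (hr : ∀ᵐ p ∂μ, p.1 = Real.sqrt (r ^ 2 + ‖p.2‖ ^ 2)) (t : ℝ) {η : ℝ} (hη : 0 < η) :
    ∃ T ∈ spaceTranslations U, ‖T ψ - (U (-t, 0) : H →L[ℂ] H) ψ‖ ≤ η := by
  have := hμ.finite
  let G : EuclideanSpace ℝ (Fin s) → ℂ := fun p =>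
    Complex.exp (Complex.I * ((Real.sqrt (r ^ 2 + ‖p‖ ^ 2) * (-t) : ℝ) : ℂ))
  have hG : Continuous G := by fun_prop
  -- The measure has total mass `‖ψ‖²`, so a uniform error `ε` costs at most `ε‖ψ‖ ≤ η` in norm.
  set ε := η / (‖ψ‖ + 1) with hε
  have hε0 : 0 < ε := by positivity
  obtain ⟨I, c, hc⟩ := exists_trigonometric_near (hΔ.image continuous_snd) hG hε0
  -- The sign of `-a` compensates the minus sign of the spatial part of the Minkowski product.
  refine ⟨∑ a ∈ I, c a • (U (0, -a) : H →L[ℂ] H), Submodule.sum_mem _ fun a _ =>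
    Submodule.smul_mem _ _ (Submodule.subset_span ⟨-a, rfl⟩), ?_⟩
  -- The extra index `none` carries the time translation with coefficient `-1`, so that the
  -- difference is a single sum.
  have h1 := hμ.norm_sum_sq hU (Finset.insertNone I) (fun o => o.elim (-1) c)
    (fun o => o.elim (-t, 0) (fun a => (0, -a)))
  simp only [Finset.sum_insertNone, Option.elim_none, Option.elim_some] at h1
  have h2 : (∑ a ∈ I, c a • (U (0, -a) : H →L[ℂ] H)) ψ - (U (-t, 0) : H →L[ℂ] H) ψ =
      (-1 : ℂ) • (U (-t, 0) : H →L[ℂ] H) ψ + ∑ a ∈ I, c a • (U (0, -a) : H →L[ℂ] H) ψ := by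
    simp only [sum_apply, smul_apply]
    module
  rw [h2]
  refine le_of_sq_le_sq ?_ hη.le
  have h3 : ∀ᵐ p ∂μ, ‖-1 * planeWave p (-t, 0) + ∑ a ∈ I, c a * planeWave p (0, -a)‖ ^ 2 ≤
      ε ^ 2 := by
    rw [← mem_ae_iff] at hμΔ
    filter_upwards [hr, hμΔ] with p hp hpΔ
    have h4 := (hc p.2 ⟨p, hpΔ, rfl⟩).le
    have h5 : planeWave p (-t, 0) = G p.2 := by
      simp only [planeWave, minkowski, G, inner_zero_right, sub_zero]
      rw [← hp]
    have h6 : ∀ a, planeWave p (0, -a) = Complex.exp (Complex.I * (⟪p.2, a⟫_ℝ : ℝ)) := by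
      intro a
      simp [planeWave, minkowski]
    simp_rw [h5, h6]
    rw [neg_one_mul, neg_add_eq_sub]
    gcongr
  rw [h1]
  calc ∫ p, ‖-1 * planeWave p (-t, 0) + ∑ a ∈ I, c a * planeWave p (0, -a)‖ ^ 2 ∂μ
      ≤ ∫ _, ε ^ 2 ∂μ := integral_mono_of_nonneg (Eventually.of_forall fun p => by positivity)
        (integrable_const _) h3
    _ = (ε * ‖ψ‖) ^ 2 := by
      rw [integral_const, hμ.measureReal_univ hU, smul_eq_mul]; ring
    _ ≤ η ^ 2 := by
      gcongr
      rw [hε, div_mul_eq_mul_div, div_le_iff₀ (by positivity)]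
      nlinarith [norm_nonneg ψ]

/-! ### Energy transfer and square integrability for creation operators -/

namespace QFT

variable {m : ℝ} {𝔄 : Type*} [CStarAlgebra 𝔄] (Q : QFT s m 𝔄 H)

lemma jointSpectrum_subset_forwardCone : jointSpectrum Q.U ⊆ forwardCone s := by
  intro p hp
  have key : ∀ a : ℝ, ‖p.2‖ ≤ Real.sqrt (a ^ 2 + ‖p.2‖ ^ 2) := fun a =>
    Real.le_sqrt_of_sq_le (by nlinarith [sq_nonneg a])
  rcases Q.spectrum_upper hp with (h | h) | h
  · rw [Set.mem_singleton_iff] at h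
    simp [forwardCone, h]
  · exact (key m).trans_eq (Eq.symm h)
  · exact (key (2 * m)).trans h

include Q in
lemma zero_notMem_massHyperboloid : (0 : Spacetime s) ∉ massHyperboloid s m := by
  intro h
  have h1 : (0 : ℝ) = Real.sqrt (m ^ 2 + ‖(0 : EuclideanSpace ℝ (Fin s))‖ ^ 2) := h
  rw [norm_zero, zero_pow two_ne_zero, add_zero, Real.sqrt_sq Q.mass_pos.le] at h1
  exact Q.mass_pos.ne h1

variable {Q} in
/-- Creation operators raise the energy by a fixed amount. -/
lemma IsCreationOperator.exists_energy_bound {A : H →L[ℂ] H} (hA : Q.IsCreationOperator A) :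
    ∃ ε : ℝ, 0 < ε ∧ ∀ p ∈ arvesonSpectrum Q.U A, ε ≤ p.1 := by
  obtain ⟨p, hp, hmin⟩ := hA.isCompact_arvesonSpectrum.exists_isMinOn
    (hA.nonempty_inter.mono Set.inter_subset_left) (continuous_fst.continuousOn (s := _))
  refine ⟨p.1, ?_, fun q hq => hmin hq⟩
  have h1 : ‖p.2‖ ≤ p.1 := hA.arvesonSpectrum_subset hp
  -- A point of the cone with zero energy is the origin; it belongs to `σ(P)` but not to the mass
  -- shell.
  refine ((norm_nonneg _).trans h1).lt_of_ne fun h0 => ?_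
  have h2 : p = 0 := Prod.ext h0.symm (norm_le_zero_iff.1 (h0 ▸ h1))
  subst h2
  exact zero_notMem_massHyperboloid Q
    (hA.inter_subset ⟨hp, Q.spectrum_lower (Or.inl rfl)⟩)

lemma inner_translate_star_mul_self (B : H →L[ℂ] H) (x : Spacetime s) (φ : H) :
    ⟪φ, translate Q.U (star B * B) x φ⟫_ℂ = ⟪translate Q.U B x φ, translate Q.U B x φ⟫_ℂ := by
  rw [Q.isTranslationRep.translate_mul, mul_apply_eq_comp,
    ← inner_conj_symm, IsTranslationRep.inner_translate_star_left, inner_conj_symm]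

variable {Q} in
-- If `R` bounds the energies in `Δ` and `ε` is the minimal energy transfer, any `n > R / ε` works:
-- after `n` steps the energy would be negative.
lemma exists_isSquareIntegrableOn {B : H →L[ℂ] H} (hB : Q.IsCreationOperator (star B))
    {Δ : Set (Spacetime s)} (hΔ : IsCompact Δ) {ψ : H} (hψ : VecSpec Q.U ψ Δ) :
    ∃ (n : ℕ) (C : ℝ), 0 ≤ C ∧ ψ ∈ annihilated Q.U B n ∧
      IsSquareIntegrableOn Q.U B (annihilated Q.U B n) C := by
  have hU := Q.isTranslationRep
  obtain ⟨ε, hε, hεS⟩ := hB.exists_energy_bound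
  obtain ⟨R, hR⟩ := hΔ.isBounded.exists_norm_le
  obtain ⟨n, hn⟩ := exists_nat_gt (R / ε)
  obtain ⟨g, hgc, hgi, hge, hcomm⟩ := hB.almostLocal.exists_commutator_bound
  have hg0 : ∀ z, 0 ≤ g z := fun z => (norm_nonneg _).trans (hcomm z)
  refine ⟨n, n * ∫ z, g z, mul_nonneg n.cast_nonneg (integral_nonneg hg0), ?_,
    fun φ hφ => integrable_norm_sq_translate hU hgc hgi hge hcomm n hφ⟩
  exact hψ.mem_annihilated hU
    (fun p hp => (norm_nonneg _).trans (Q.jointSpectrum_subset_forwardCone hp))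
    hB.isCompact_arvesonSpectrum hεS n ((div_lt_iff₀ hε).1 hn) hΔ
    (fun p hp => (le_abs_self _).trans ((norm_fst_le p).trans (hR p hp)))

end QFT

end

end HaagKastler

theorem mainTheorem11 {s : ℕ} {m : ℝ} {𝔄 : Type*} [CStarAlgebra 𝔄]
    {H : Type*} [NormedAddCommGroup H] [InnerProductSpace ℂ H] [CompleteSpace H]
    (Q : HaagKastler.QFT s m 𝔄 H)
    (B : H →L[ℂ] H) (hB : Q.IsCreationOperator (star B))
    (Δ : Set (HaagKastler.Spacetime s)) (hΔ : IsCompact Δ)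
    (ψ : H) (hψΔ : ψ ∈ HaagKastler.spectralSubspace Q.U Δ)
    (hψ : HaagKastler.IsMassEigenvector Q.U ψ) :
    (∀ t : ℝ, Integrable (Q.detectorDensity B ψ t)) ∧
    ∀ t : ℝ, ∫ x, Q.detectorDensity B ψ t x =
      ∫ x, ⟪ψ, HaagKastler.translate Q.U (star B * B) (0, x) ψ⟫_ℂ := by
  have hU := Q.isTranslationRep
  obtain ⟨μ₁, hμ₁, hμ₁Δ⟩ := hψΔ
  have hspec : HaagKastler.VecSpec Q.U ψ Δ := hμ₁.vecSpec hU hμ₁Δ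
  obtain ⟨n, C, hC, hψn, hW⟩ := HaagKastler.QFT.exists_isSquareIntegrableOn hB hΔ hspec
  have hWU : ∀ φ ∈ HaagKastler.annihilated Q.U B n, ∀ x,
      (Q.U x : H →L[ℂ] H) φ ∈ HaagKastler.annihilated Q.U B n :=
    fun φ hφ x => HaagKastler.apply_mem_annihilated hU hφ x
  obtain ⟨-, c, hc⟩ := hψ
  obtain ⟨μ, hμ, hμc⟩ := HaagKastler.ae_eq_of_mem_functionalCalculusGraph hU hc
  -- The measure `μ` comes from the mass operator and `μ₁` from the spectral subspace; the support
  -- in `Δ` is carried over through `hspec`.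
  have hμΔ : μ Δᶜ = 0 := hμ.measure_compl_eq_zero hΔ.isClosed (hspec ψ)
  have hμJ : μ (HaagKastler.jointSpectrum Q.U)ᶜ = 0 :=
    hμ.measure_compl_eq_zero (HaagKastler.isClosed_fourierSupport _)
      (HaagKastler.VecSpec.jointSpectrum hU ψ ψ)
  -- The mass determines `p₀` only up to sign and only where `p₀² ≥ |𝐩|²`; the spectrum condition
  -- supplies both the sign and the inequality.
  have hmass : ∀ᵐ p ∂μ, p.1 = Real.sqrt (c.re ^ 2 + ‖p.2‖ ^ 2) := by
    rw [← mem_ae_iff] at hμJ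
    filter_upwards [hμc, hμJ] with p hp hpJ
    have hcone : ‖p.2‖ ≤ p.1 := Q.jointSpectrum_subset_forwardCone hpJ
    have h0 := norm_nonneg p.2
    have h1 : c.re = Real.sqrt (p.1 ^ 2 - ‖p.2‖ ^ 2) := by rw [← hp, Complex.ofReal_re]
    rw [h1, Real.sq_sqrt (by nlinarith), sub_add_cancel, Real.sqrt_sq (h0.trans hcone)]
  have hdens : ∀ t x, Q.detectorDensity B ψ t x =
      ⟪HaagKastler.translate Q.U B (0, x) ((Q.U (-t, 0) : H →L[ℂ] H) ψ),
        HaagKastler.translate Q.U B (0, x) ((Q.U (-t, 0) : H →L[ℂ] H) ψ)⟫_ℂ :=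
    fun t x => Q.inner_translate_star_mul_self B (0, x) _
  refine ⟨fun t => ?_, fun t => ?_⟩
  · have h := hW.integrable_inner hU (hWU ψ hψn (-t, 0)) (hWU ψ hψn (-t, 0))
    exact h.congr (Filter.Eventually.of_forall fun x => (hdens t x).symm)
  · simp_rw [hdens, Q.inner_translate_star_mul_self]
    exact hW.detectorForm_eq hU hC hWU hψn (-t, 0) fun η hη =>
      HaagKastler.exists_spaceTranslation_near hU hμ hΔ hμΔ hmass t hη
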